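/- **Setting.** A game $a\to h$ is played by team $a$ (away) at the home of team $h$ (home); for a set $D$ of games, $\overline D$ is $D$ with all venues reversed, and for a sequence of days $\overline{D_0\cdots D_s}=\overline{D_0}\cdots\overline{D_s}$. A *double round-robin* for a set $T$ of teams consists of $2(|T|-1)$ days on which only games between two different teams of $T$ are played, such that every team plays exactly one game each day and, for any two different teams $a,h\in T$, the game $a\to h$ is played on exactly one day. It is a *feasible TTP-$k$ schedule* if moreover no two teams play each other on two consecutive days (no-repeat), and no team plays more than $k$ consecutive home games or more than $k$ consecutive away games (bounded-by-$k$). **Input of the construction.** Let $k\ge 3$, let $n\ge 8k^2$ be even, $m=2\lfloor n/4k\rfloor$ and $r=(n-2mk)/2$. Let $V$ be a set of $n$ teams, $S\subseteq V$ any subset with $2mk$ elements, and $\mathcal C_k$ a $k$-cycle packing of the complete graph on $S$, i.e. a set of edges every component of which is a $k$-cycle and which covers all of $S$. The teams are listed as $t_0,\dots,t_{n-1}$ so that $S=\{t_0,\dots,t_{2mk-1}\}$ and $(t_{ki},t_{ki+1},\dots,t_{ki+k-1},t_{ki})$ is a cycle of $\mathcal C_k$ for each $0\le i<2m$; otherwise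 the list is arbitrary. Put $u_i=(t_{ki},\dots,t_{ki+k-1})$ for $0\le i<2m$ (cycle-teams), $U_i=u_{2i}\cup u_{2i+1}=(t_{2ki},\dots,t_{2ki+2k-1})$ for $0\le i<m$ (super-teams), and $R_i=(t_{2mk+2i},t_{2mk+2i+1})$ for $0\le i<r$ (team-pairs). **Time slots.** There are $m-1$ time slots $q=0,\dots,m-2$, and in each of them $m/2$ columns $c=0,\dots,m/2-1$ with one super-game each. In slot $q$, position $p\in\{0,\dots,m-2\}$ is held by the super-team $U_{(p-q)\bmod (m-1)}$, while $U_{m-1}$ does not move. The upper super-team of column $c\ge1$ is the one at position $c-1$, the upper super-team of column $0$ is $U_{m-1}$, and the lower super-team of column $c$ is the one at position $m-2-c$. The direction of the super-games alternates from column to column and from slot to slot: in one of the two parity classes of $c+q$ (chosen arbitrarily once and for all) the upper super-team plays away, in the other one the lower super-team does. The rightmost $r$ columns hold right super-games, column $m/2-1-i$ together with team-pair $R_i$. Of the other columns, column $0$ holds a left super-game; the remaining ones hold normal super-games in slots $q<m-2$, and left super-games in the last slot $q=m-2$. Each super-game takes the $4k$ days of its slot: * In a normal or left super-game $U_i\to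 U_j$, the cycle-games $u_{2i}\to u_{2j}$ and $u_{2i+1}\to u_{2j+1}$ are played simultaneously on the first $2k$ days, and then $u_{2i}\to u_{2j+1}$ and $u_{2i+1}\to u_{2j}$ on the other $2k$ days. For a cycle-game $(x_0,\dots,x_{k-1})\to(y_0,\dots,y_{k-1})$ let $p_l=\{x_a\to y_{(a+l)\bmod k}:0\le a<k\}$. In a normal super-game the $2k$ days of a cycle-game are $E\cdot\overline E$ with $E=p_0p_1\cdots p_{k-1}$; in a left super-game they are $E\cdot\overline E$ with $E=p_0\cdots p_{k-2}\,\overline{p_{k-1}}$. * In a right super-game $(x_0,\dots,x_{2k-1})\to(y_0,\dots,y_{2k-1})$ with team-pair $R_i$, the two teams of $R_i$ are taken as $x_{2k}$ and $y_{2k}$, the first team of $R_i$ joining the upper super-team. With $p_l=\{x_a\to y_{(2l-a)\bmod(2k+1)}:0\le a\le 2k\}$, the $4k$ days are $E_0\,\overline{E_0}\,E_1\,\overline{E_1}$, where $E_0=p_0\cdots p_{k-3}\,\overline{p_{k-2}}\,p_{k-1}$ and $E_1=p_k\cdots p_{2k-3}\,\overline{p_{2k-2}}\,p_{2k-1}$.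 **Leftover games.** The remaining $4k+4r-2$ days follow the last time slot. The $2k+2r$ teams of $U_{m-1}\cup R_0\cup\dots\cup R_{r-1}$ play an arbitrary feasible TTP-2 schedule on these days. At the same time the other super-teams first play, for $i=0,\dots,r-1$ in turn, the four days $s_1\,s_2\,\overline{s_1}\,\overline{s_2}$, where, with $b(a)=(a+2i+1)\bmod(m-1)$, $$s_1=\{t_{2ka+j}\to t_{2kb(a)+2k-1-j}\},\qquad s_2=\{t_{2ka+2k-1-j}\to t_{2kb(a)+j}\}\qquad(0\le a<m-1,\ 0\le j<k),$$ and then each super-team $U_a$ ($a<m-1$) plays an arbitrary feasible TTP-2 schedule among its own $2k$ teams on the last $4k-2$ days. **Theorem.** For all such $k$, $n$, $V$, $S$ and $\mathcal C_k$, the construction can be carried out (a list of the teams as above exists, and so do feasible TTP-2 schedules for $U_{m-1}\cup R_0\cup\dots\cup R_{r-1}$ and for each $U_a$, $a<m-1$), and, whatever choices are made, the resulting schedule is a feasible TTP-$k$ schedule for the $n$ teams of $V$: it is a complete double round-robin on $2(n-1)$ days which satisfies the no-repeat and bounded-by-$k$ conditions. -/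

import Mathlib

namespace TTP

/-! # Tournament schedules

A game is a pair `(a, h)`: team `a` plays away, at the home of team `h`. A schedule lists the games
of every day; days are counted from `0`, and only the days before the length of the tournament
matter. -/

/-- A schedule: the set of games `(away, home)` of each day. -/
abbrev Schedule (V : Type*) := ℕ → Finset (V × V)

section Feasibility

variable {V : Type*}

/-- The number of days of a double round-robin on the set `T` of teams. -/
def numDays (T : Finset V) : ℕ := 2 * (T.card - 1)

/-- `s` is a double round-robin on the set `T` of teams: all games are between two different teams
of `T`, each team plays exactly one game a day, and for any two different teams `a`, `h` there is
exactly one day on which `a` plays at the home of `h`. -/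
structure IsDoubleRoundRobin (T : Finset V) (s : Schedule V) : Prop where
  mem_teams : ∀ d < numDays T, ∀ g ∈ s d, g.1 ∈ T ∧ g.2 ∈ T ∧ g.1 ≠ g.2
  one_game_a_day : ∀ d < numDays T, ∀ v ∈ T, ∃! g, g ∈ s d ∧ (g.1 = v ∨ g.2 = v)
  each_game_once : ∀ a ∈ T, ∀ h ∈ T, a ≠ h → ∃! d, d < numDays T ∧ (a, h) ∈ s d

/-- No-repeat: two teams do not play against each other on two consecutive days. -/
def NoRepeat (T : Finset V) (s : Schedule V) : Prop :=
  ∀ d, d + 1 < numDays T → ∀ a b, (a, b) ∈ s d → (a, b) ∉ s (d + 1) ∧ (b, a) ∉ s (d + 1)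

/-- Bounded-by-`k`: no team plays `k + 1` consecutive home games or `k + 1` consecutive away
games. -/
def BoundedBy (k : ℕ) (T : Finset V) (s : Schedule V) : Prop :=
  ∀ v ∈ T, ∀ d, d + k < numDays T →
    (¬ ∀ i ≤ k, ∃ a, (a, v) ∈ s (d + i)) ∧ (¬ ∀ i ≤ k, ∃ h, (v, h) ∈ s (d + i))

/-- A feasible schedule of TTP-`k` for the set `T` of teams. -/
structure IsFeasible (k : ℕ) (T : Finset V) (s : Schedule V) : Prop where
  doubleRoundRobin : IsDoubleRoundRobin T s
  noRepeat : NoRepeat T s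
  boundedBy : BoundedBy k T s

end Feasibility

/-! # Parameters, cycle packings and labellings -/

/-- The number `m = 2⌊n / 4k⌋` of super-teams. -/
def numSuper (k n : ℕ) : ℕ := 2 * (n / (4 * k))

/-- The number `r = (n - 2mk) / 2` of team-pairs. -/
def numPairs (k n : ℕ) : ℕ := (n - 2 * numSuper k n * k) / 2

/-- A `k`-cycle packing in the complete graph on `W`: a set of edges each of whose connected
components is a `k`-cycle (every vertex lies in a component, so all vertices are covered). -/
def IsCyclePacking (k : ℕ) {W : Type*} (P : SimpleGraph W) : Prop :=
  ∀ c : P.ConnectedComponent, Nonempty (c.toSimpleGraph ≃g SimpleGraph.cycleGraph k)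

/-- `t` lists the teams as `t 0, …, t (n - 1)` in accordance with the packing `P` of `S`: the teams
of `S` are `t 0, …, t (2mk - 1)`, and for every `i < 2m` the sequence
`t (k * i), t (k * i + 1), …, t (k * i + (k - 1)), t (k * i)` runs through a cycle of `P`. -/
structure IsLabelling {V : Type*} (k m : ℕ) {n : ℕ} (S : Finset V) (P : SimpleGraph S)
    (t : Fin n ≃ V) : Prop where
  mem_iff : ∀ a : Fin n, t a ∈ S ↔ (a : ℕ) < 2 * m * k
  adj : ∀ (a b : Fin n) (ha : t a ∈ S) (hb : t b ∈ S), (a : ℕ) / k = (b : ℕ) / k →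
    (b : ℕ) % k = ((a : ℕ) % k + 1) % k → P.Adj ⟨t a, ha⟩ ⟨t b, hb⟩

/-! # The construction

The construction is written for the labels `0, …, n - 1` of the teams. Everything is counted
from `0`: cycle-team `i < 2m` consists of the teams `k * i + j` with `j < k`, super-team `U < m` of
the teams `2 * k * U + j` with `j < 2k` (so of the cycle-teams `2 * U` and `2 * U + 1`), and
team-pair `i < r` of the teams `2 * k * m + 2 * i` and `2 * k * m + 2 * i + 1`. -/

/-- The labels of the teams of super-team `U`. -/
def superTeam (k U : ℕ) : Finset ℕ := Finset.Ico (2 * k * U) (2 * k * (U + 1))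

/-- The labels of the teams of the last super-team and of all the team-pairs. -/
def lastTeams (k m r : ℕ) : Finset ℕ := Finset.Ico (2 * k * (m - 1)) (2 * k * m + 2 * r)

/-- The games of a day with all venues reversed. -/
def rev (D : Finset (ℕ × ℕ)) : Finset (ℕ × ℕ) := D.image Prod.swap

/-- The `2k` days `e₀ ⋯ eₖ₋₁` followed by the same days with all venues reversed. -/
def mirrored (k : ℕ) (e : Schedule ℕ) : Schedule ℕ :=
  fun d => if d < k then e d else rev (e (d - k))

/-- The day `p_l` of a cycle-game between cycle-teams `a` and `b` at the home of `b`. -/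
def cycleDay (k a b l : ℕ) : Finset (ℕ × ℕ) :=
  (Finset.range k).image fun i => (k * a + i, k * b + (i + l) % k)

/-- A normal cycle-game `a → b` (`2k` days). -/
def normalCycleGame (k a b : ℕ) : Schedule ℕ := mirrored k (cycleDay k a b)

/-- A left cycle-game `a → b` (`2k` days): as a normal cycle-game, with the venues of the last day
of each half reversed. -/
def leftCycleGame (k a b : ℕ) : Schedule ℕ :=
  mirrored k fun l => if l = k - 1 then rev (cycleDay k a b l) else cycleDay k a b l

/-- A super-game `U → W` (`4k` days) made of the cycle-games `game a b` between the cycle-teams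
of `U` and `W`, in two sub-time slots of `2k` days. -/
def superGame (k : ℕ) (game : ℕ → ℕ → Schedule ℕ) (U W : ℕ) : Schedule ℕ := fun d =>
  if d < 2 * k then game (2 * U) (2 * W) d ∪ game (2 * U + 1) (2 * W + 1) d
  else game (2 * U) (2 * W + 1) (d - 2 * k) ∪ game (2 * U + 1) (2 * W) (d - 2 * k)

/-- The team with index `j ≤ 2k` among the teams of super-team `U` followed by the extra
team `e`. -/
def extended (k U e j : ℕ) : ℕ := if j = 2 * k then e else 2 * k * U + j

/-- The day `p_l` of a right super-game `U → W`, where the extra team `e` joins `U` and the extra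
team `f` joins `W`. -/
def rightDay (k U e W f l : ℕ) : Finset (ℕ × ℕ) :=
  (Finset.range (2 * k + 1)).image fun i =>
    (extended k U e i, extended k W f ((2 * k + 1 + 2 * l - i) % (2 * k + 1)))

/-- The first half (for `s = 0`) or the second half (for `s = k`) of a right super-game
(`2k` days): the days `p_s ⋯ p_{s+k-1}` with the venues of the last but one reversed, followed by
the same days with all venues reversed. -/
def rightHalf (k U e W f s : ℕ) : Schedule ℕ :=
  mirrored k fun l =>
    if l = k - 2 then rev (rightDay k U e W f (s + l)) else rightDay k U e W f (s + l)

/-- A right super-game `U → W` (`4k` days), with the team-pair `{e, f}`. -/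
def rightSuperGame (k U e W f : ℕ) : Schedule ℕ := fun d =>
  if d < 2 * k then rightHalf k U e W f 0 d else rightHalf k U e W f k (d - 2 * k)

/-- The super-team at position `p < m - 1` of the rotating cycle in time slot `q < m - 1`: in each
time slot every super-team but the last one moves on by one position. -/
def atPosition (m q p : ℕ) : ℕ := (p + (m - 1) - q) % (m - 1)

/-- The upper super-team of column `c < m / 2` in time slot `q`. In the leftmost column it is the
super-team `m - 1`, which does not move. -/
def upper (m q c : ℕ) : ℕ := if c = 0 then m - 1 else atPosition m q (c - 1)

/-- The lower super-team of column `c < m / 2` in time slot `q`. -/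
def lower (m q c : ℕ) : ℕ := atPosition m q (m - 2 - c)

/-- The super-game of column `c < m / 2` in time slot `q < m - 1`. Directions alternate from column
to column and from slot to slot; `δ` tells whether super-team `m - 1` plays away in the first
slot. The rightmost `r` columns hold right super-games, where team-pair `i` stays in column
`m / 2 - 1 - i` and its first team joins the upper super-team. The leftmost column holds a left
super-game, and so do, in the last slot, all the other columns that are not right. -/
def columnGame (k m r : ℕ) (δ : Bool) (q c : ℕ) : Schedule ℕ :=
  let U := upper m q c
  let W := lower m q c
  let e := 2 * k * m + 2 * (m / 2 - 1 - c)
  let f := e + 1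
  if m / 2 ≤ c + r then
    if ((c + q) % 2 = 0 ↔ δ = true) then rightSuperGame k U e W f else rightSuperGame k W f U e
  else
    let game := if c = 0 ∨ q = m - 2 then leftCycleGame k else normalCycleGame k
    if ((c + q) % 2 = 0 ↔ δ = true) then superGame k game U W else superGame k game W U

/-- The games of time slot `q < m - 1` (`4k` days). -/
def slot (k m r : ℕ) (δ : Bool) (q : ℕ) : Schedule ℕ := fun d =>
  (Finset.range (m / 2)).biUnion fun c => columnGame k m r δ q c d

/-- The days `s₁` (for `z = 0`) and `s₂` (for `z = 1`) for team-pair `i`. The right super-games with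
team-pair `i` are those between the super-teams `a` and `a + (2i + 1)` modulo `m - 1`, and they
leave open the two games between team `j` of the former and team `2k - 1 - j` of the latter, for
each `j < 2k`. -/
def leftoverDay (k m i z : ℕ) : Finset (ℕ × ℕ) :=
  (Finset.range (m - 1) ×ˢ Finset.range k).image fun x =>
    let a := x.1
    let b := (x.1 + (2 * i + 1)) % (m - 1)
    let j := x.2
    if z = 0 then (2 * k * a + j, 2 * k * b + (2 * k - 1 - j))
    else (2 * k * a + (2 * k - 1 - j), 2 * k * b + j)

/-- The games left open by the right super-games (`4r` days): `s₁ s₂` and then `s₁ s₂` with all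
venues reversed, for one team-pair after the other. -/
def leftoverGames (k m : ℕ) : Schedule ℕ := fun d =>
  mirrored 2 (leftoverDay k m (d / 4)) (d % 4)

/-- The unarranged games (`4k + 4r - 2` days). The last super-team and the team-pairs play the
double round-robin `A`. At the same time the other super-teams first play the games left open by
the right super-games, and then each of them, say `U`, plays its own double round-robin `B U`. -/
def finalDays (k m r : ℕ) (A : Schedule ℕ) (B : ℕ → Schedule ℕ) : Schedule ℕ := fun d =>
  A d ∪ if d < 4 * r then leftoverGames k m d
    else (Finset.range (m - 1)).biUnion fun U => B U (d - 4 * r)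

/-- The whole schedule, on labels: `m - 1` time slots of `4k` days each, then the unarranged
games. -/
def labelSchedule (k m r : ℕ) (δ : Bool) (A : Schedule ℕ) (B : ℕ → Schedule ℕ) : Schedule ℕ :=
  fun d =>
    if d < 4 * k * (m - 1) then slot k m r δ (d / (4 * k)) (d % (4 * k))
    else finalDays k m r A B (d - 4 * k * (m - 1))

/-- Admissible choices for the double round-robins that the construction takes for the leftover
games: feasible TTP-2 schedules, `A` for the last super-team together with all the team-pairs, and
`B U` for each other super-team `U`. -/
structure IsLeftoverChoice (k m r : ℕ) (A : Schedule ℕ) (B : ℕ → Schedule ℕ) : Prop where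
  last : IsFeasible 2 (lastTeams k m r) A
  other : ∀ U < m - 1, IsFeasible 2 (superTeam k U) (B U)

/-- The schedule of the `k`-cycle-packing construction for the `n` teams `t 0, …, t (n - 1)`. -/
def packingSchedule {V : Type*} [Fintype V] {n : ℕ} (k : ℕ) (t : Fin n ≃ V)
    (δ : Bool) (A : Schedule ℕ) (B : ℕ → Schedule ℕ) : Schedule V := fun d =>
  Finset.univ.filter fun g : V × V =>
    ((t.symm g.1 : ℕ), (t.symm g.2 : ℕ)) ∈
      labelSchedule k (numSuper k n) (numPairs k n) δ A B d

end TTP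

/-! Feasibility is first reduced to existence statements (`isFeasible_of_plays`). With 2h teams and
at most h games a day, the 2(2h - 1) days have room for no more games than there are ordered pairs
of teams. Hence if every ordered pair occurs, none occurs twice; and if every team plays every day,
none plays twice a day. If moreover the reversal of each game occurs on some day other than the next
(`MirrorClosed`), then no-repeat follows from uniqueness, and it suffices that any two teams meet
once in either direction (`Meets`). For bounded-by-k one exhibits a word of venues for each team and
shows that it has no long run (`NoRun`). All these properties pass through unions and concatenations
of schedules, so the construction can be checked piece by piece.

Venues in the slots: a super-game consists of four blocks of k days with alternating venues, except
that one day σ of each block is reversed (k - 2 in right games, k - 1 in left games, σ = k meaning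
none). Days at distance k inside a slot therefore have opposite venues, and only the borders between
slots matter (`IsSlotVenue`). Teams that keep their column (the last super-team and the pairs) have
a reversed day in every slot, so the last two days of each block differ. For a rotating super-team
the alternating directions give the same initial venue in consecutive slots, except when it leaves
column 0; there the left game, reversed on its last day, compensates (`exists_isSlotVenue`). In the
last slot every game has a reversed day, which keeps runs from reaching far into the leftover days,
whose words have runs of at most 3 ≤ k.

Meetings: m - 1 is odd, so the differences 2c modulo m - 1 realised by the columns c > 0 cover, up
to sign, every nonzero residue once. In a right super-game, halving modulo 2k + 1 assigns each pair
of indices to a day; the one missing day leaves the game within the team-pair, which belongs to `A`,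
and the pairs with index sum 2k - 1, which are the leftover days.

The auxiliary TTP-2 schedules come from the circle method, its second half starting with day 1
instead of day 0 (`circleSchedule`). -/

namespace TTP

/-! ### Counting criterion for feasibility -/

section Criterion

variable {V : Type*}

/-- Team `v` has a game on the day `D`: away if `b` is true, at home otherwise. -/
def Plays (D : Finset (V × V)) (v : V) (b : Bool) : Prop :=
  ∃ w, (if b = true then (v, w) else (w, v)) ∈ D

/-- Every game of the first `L` days is also played with venues reversed on one of these days, and
not on the day after. -/
def MirrorClosed (L : ℕ) (s : Schedule V) : Prop :=
  ∀ d < L, ∀ g ∈ s d, ∃ d' < L, d' ≠ d + 1 ∧ g.swap ∈ s d'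

/-- Teams `a` and `b` play against each other on one of the first `L` days. -/
def Meets (L : ℕ) (s : Schedule V) (a b : V) : Prop :=
  ∃ d < L, (a, b) ∈ s d ∨ (b, a) ∈ s d

/-- No `k + 1` consecutive entries among the first `L` entries of `w` are equal. -/
def NoRun (k L : ℕ) (w : ℕ → Bool) : Prop :=
  ∀ d, d + k < L → ∃ i ≤ k, w (d + i) ≠ w d

theorem Plays.mono {D E : Finset (V × V)} (h : D ⊆ E) {v : V} {b : Bool} (hp : Plays D v b) :
    Plays E v b :=
  hp.imp fun _ hw => h hw

theorem Plays.exists_mem {D : Finset (V × V)} {v : V} {b : Bool} (hp : Plays D v b) :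
    ∃ g ∈ D, g.1 = v ∨ g.2 = v := by
  obtain ⟨w, hw⟩ := hp
  refine ⟨_, hw, ?_⟩
  split_ifs <;> simp

theorem Meets.symm {L : ℕ} {s : Schedule V} {a b : V} (h : Meets L s a b) : Meets L s b a := by
  obtain ⟨d, hd, h⟩ := h
  exact ⟨d, hd, h.symm⟩

theorem MirrorClosed.exists_mem {L : ℕ} {s : Schedule V} (h : MirrorClosed L s) {a b : V}
    (hab : Meets L s a b) : ∃ d < L, (a, b) ∈ s d := by
  obtain ⟨d, hd, hab | hab⟩ := hab
  · exact ⟨d, hd, hab⟩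
  · obtain ⟨d', hd', -, h'⟩ := h d hd _ hab
    exact ⟨d', hd', h'⟩

/-- A schedule with at most `h` games a day in which each of the `2h` teams plays every day and all
games occur is a double round-robin. -/
theorem isDoubleRoundRobin_of_card_le {T : Finset V} {s : Schedule V} {h : ℕ}
    (hT : T.card = 2 * h) (hcard : ∀ d < numDays T, (s d).card ≤ h)
    (hgame : ∀ a ∈ T, ∀ b ∈ T, a ≠ b → ∃ d < numDays T, (a, b) ∈ s d)
    (hday : ∀ d < numDays T, ∀ v ∈ T, ∃ g ∈ s d, g.1 = v ∨ g.2 = v) :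
    IsDoubleRoundRobin T s := by
  classical
  set X : Finset (Σ _ : ℕ, V × V) := (Finset.range (numDays T)).sigma s with hX
  -- The total number of games is at most h · 2(2h - 1), the number of ordered pairs of distinct
  -- teams; so the map from played games to pairs, being onto, is a bijection.
  have hXcard : X.card ≤ T.offDiag.card := by
    rw [hX, Finset.card_sigma, Finset.offDiag_card, hT]
    refine (Finset.sum_le_card_nsmul _ _ h fun d hd => hcard d (Finset.mem_range.1 hd)).trans ?_
    rw [Finset.card_range, smul_eq_mul, numDays, hT]
    rcases h with _ | h
    · simp
    · have : 2 * (h + 1) - 1 = 2 * h + 1 := by omega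
      rw [this]
      apply Nat.le_sub_of_add_le
      apply le_of_eq
      ring
  have hsub : T.offDiag ⊆ X.image Sigma.snd := by
    intro g hg
    rw [Finset.mem_offDiag] at hg
    obtain ⟨d, hd, hgd⟩ := hgame _ hg.1 _ hg.2.1 hg.2.2
    exact Finset.mem_image.2
      ⟨⟨d, g⟩, Finset.mem_sigma.2 ⟨Finset.mem_range.2 hd, hgd⟩, rfl⟩
  have himage : T.offDiag = X.image Sigma.snd :=
    Finset.eq_of_subset_of_card_le hsub (Finset.card_image_le.trans hXcard)
  have hinj : Set.InjOn (Sigma.snd : (Σ _ : ℕ, V × V) → V × V) X := by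
    rw [← Finset.card_image_iff]
    exact le_antisymm Finset.card_image_le (by rw [← himage]; exact hXcard)
  have hmem : ∀ d < numDays T, ∀ g ∈ s d, g.1 ∈ T ∧ g.2 ∈ T ∧ g.1 ≠ g.2 := by
    intro d hd g hg
    rw [← Finset.mem_offDiag, himage]
    exact Finset.mem_image.2
      ⟨⟨d, g⟩, Finset.mem_sigma.2 ⟨Finset.mem_range.2 hd, hg⟩, rfl⟩
  refine ⟨hmem, ?_, ?_⟩
  · intro d hd v hv
    -- Double counting of incidences: at most h games with two teams each give at most 2h = |T|.
    -- Every summand is at least 1, so all are equal to 1.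
    have hsum : ∑ v ∈ T, ((s d).filter fun g => g.1 = v ∨ g.2 = v).card ≤ ∑ _v ∈ T, 1 := by
      calc ∑ v ∈ T, ((s d).filter fun g => g.1 = v ∨ g.2 = v).card
          = ∑ g ∈ s d, (T.filter fun v => g.1 = v ∨ g.2 = v).card := by
            simp only [Finset.card_filter]
            exact Finset.sum_comm
        _ ≤ ∑ g ∈ s d, 2 := by
            refine Finset.sum_le_sum fun g _ => ?_
            refine (Finset.card_le_card (t := {g.1, g.2}) ?_).trans Finset.card_le_two
            intro v hv
            rw [Finset.mem_filter] at hv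
            rcases hv.2 with h | h <;> simp [h]
        _ ≤ ∑ _v ∈ T, 1 := by
            simp only [Finset.sum_const, smul_eq_mul, hT]
            have := hcard d hd
            omega
    have hpos : ∀ v ∈ T, 1 ≤ ((s d).filter fun g => g.1 = v ∨ g.2 = v).card := by
      intro v hv
      obtain ⟨g, hg, hgv⟩ := hday d hd v hv
      exact Finset.card_pos.2 ⟨g, Finset.mem_filter.2 ⟨hg, hgv⟩⟩
    have heq := (Finset.sum_eq_sum_iff_of_le hpos).1
      (le_antisymm (Finset.sum_le_sum hpos) hsum) v hv
    obtain ⟨g, hg⟩ := Finset.card_eq_one.1 heq.symm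
    refine ⟨g, ?_, fun g' hg' => ?_⟩
    · simpa using (Finset.mem_filter.1 (hg ▸ Finset.mem_singleton_self g))
    · have : g' ∈ (s d).filter fun g => g.1 = v ∨ g.2 = v := Finset.mem_filter.2 hg'
      rwa [hg, Finset.mem_singleton] at this
  · intro a ha b hb hab
    obtain ⟨d, hd, hgd⟩ := hgame a ha b hb hab
    refine ⟨d, ⟨hd, hgd⟩, fun d' hd' => ?_⟩
    have := @hinj ⟨d', (a, b)⟩
      (Finset.mem_coe.2 (Finset.mem_sigma.2 ⟨Finset.mem_range.2 hd'.1, hd'.2⟩)) ⟨d, (a, b)⟩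
      (Finset.mem_coe.2 (Finset.mem_sigma.2 ⟨Finset.mem_range.2 hd, hgd⟩)) rfl
    exact congrArg Sigma.fst this

theorem IsDoubleRoundRobin.plays_unique {T : Finset V} {s : Schedule V}
    (hs : IsDoubleRoundRobin T s) {d : ℕ} (hd : d < numDays T) {v : V} (hv : v ∈ T) {b c : Bool}
    (hb : Plays (s d) v b) (hc : Plays (s d) v c) : b = c := by
  obtain ⟨x, hx⟩ := hb
  obtain ⟨y, hy⟩ := hc
  have hne := (hs.mem_teams d hd _ hx).2.2
  have := (hs.one_game_a_day d hd v hv).unique ⟨hx, by split_ifs <;> simp⟩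
    ⟨hy, by split_ifs <;> simp⟩
  cases b <;> cases c <;> simp_all

/-- A criterion for feasibility in which nothing is to be checked to be unique. -/
theorem isFeasible_of_plays {k : ℕ} {T : Finset V} {s : Schedule V} {h : ℕ}
    (hT : T.card = 2 * h) (hcard : ∀ d < numDays T, (s d).card ≤ h)
    (hmirror : MirrorClosed (numDays T) s)
    (hmeets : ∀ a ∈ T, ∀ b ∈ T, a ≠ b → Meets (numDays T) s a b)
    (hplays : ∀ v ∈ T, ∃ w : ℕ → Bool,
      (∀ d < numDays T, Plays (s d) v (w d)) ∧ NoRun k (numDays T) w) :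
    IsFeasible k T s := by
  have hs : IsDoubleRoundRobin T s := by
    refine isDoubleRoundRobin_of_card_le hT hcard ?_ ?_
    · exact fun a ha b hb hab => hmirror.exists_mem (hmeets a ha b hb hab)
    · intro d hd v hv
      obtain ⟨w, hw, -⟩ := hplays v hv
      exact (hw d hd).exists_mem
  refine ⟨hs, ?_, ?_⟩
  · intro d hd a b hab
    have hd' : d < numDays T := by omega
    obtain ⟨ha, hb, hne⟩ := hs.mem_teams d hd' _ hab
    constructor
    · intro h'
      have := (hs.each_game_once a ha b hb hne).unique ⟨hd', hab⟩ ⟨hd, h'⟩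
      omega
    · intro h'
      -- The reversed game occurs only once, and `hmirror` places it on a day other than d + 1.
      obtain ⟨e, he, hne', hmem⟩ := hmirror d hd' _ hab
      exact hne' ((hs.each_game_once b hb a ha hne.symm).unique ⟨he, hmem⟩ ⟨hd, h'⟩)
  · intro v hv d hd
    obtain ⟨w, hw, hrun⟩ := hplays v hv
    obtain ⟨i, hi, hne⟩ := hrun d hd
    have key : ∀ b, ¬ ∀ i ≤ k, Plays (s (d + i)) v b := by
      intro b hb
      have h1 := hs.plays_unique (by omega) hv (hb i hi) (hw (d + i) (by omega))
      have h2 := hs.plays_unique (by omega) hv (hb 0 (by omega)) (hw (d + 0) (by omega))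
      exact hne (h1.symm.trans h2)
    exact ⟨by simpa [Plays] using key false, by simpa [Plays] using key true⟩

theorem IsFeasible.mirrorClosed {k : ℕ} {T : Finset V} {s : Schedule V} (hs : IsFeasible k T s) :
    MirrorClosed (numDays T) s := by
  intro d hd g hg
  obtain ⟨h1, h2, hne⟩ := hs.doubleRoundRobin.mem_teams d hd g hg
  obtain ⟨d', ⟨hd', hmem⟩, -⟩ := hs.doubleRoundRobin.each_game_once _ h2 _ h1 hne.symm
  refine ⟨d', hd', ?_, hmem⟩
  rintro rfl
  exact (hs.noRepeat d hd' g.1 g.2 hg).2 hmem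

theorem IsDoubleRoundRobin.meets {T : Finset V} {s : Schedule V} (hs : IsDoubleRoundRobin T s)
    {a b : V} (ha : a ∈ T) (hb : b ∈ T) (hab : a ≠ b) : Meets (numDays T) s a b := by
  obtain ⟨d, ⟨hd, hmem⟩, -⟩ := hs.each_game_once a ha b hb hab
  exact ⟨d, hd, Or.inl hmem⟩

theorem IsFeasible.exists_plays {k : ℕ} {T : Finset V} {s : Schedule V} (hs : IsFeasible k T s)
    {v : V} (hv : v ∈ T) : ∃ w : ℕ → Bool,
      (∀ d < numDays T, Plays (s d) v (w d)) ∧ NoRun k (numDays T) w := by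
  have hex : ∀ d, ∃ b, d < numDays T → Plays (s d) v b := by
    intro d
    by_cases hd : d < numDays T
    · obtain ⟨⟨x, y⟩, ⟨hg, rfl | rfl⟩, -⟩ := hs.doubleRoundRobin.one_game_a_day d hd v hv
      · exact ⟨true, fun _ => ⟨y, by simpa using hg⟩⟩
      · exact ⟨false, fun _ => ⟨x, by simpa using hg⟩⟩
    · exact ⟨true, fun h => absurd h hd⟩
  choose w hw using hex
  refine ⟨w, hw, fun d hd => ?_⟩
  by_contra! hcon
  have hall : ∀ i ≤ k, Plays (s (d + i)) v (w d) := fun i hi => hcon i hi ▸ hw (d + i) (by omega)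
  obtain ⟨h1, h2⟩ := hs.boundedBy v hv d hd
  cases hb : w d
  · exact h1 (by simpa [Plays, hb] using hall)
  · exact h2 (by simpa [Plays, hb] using hall)

/-- Each game involves exactly two teams and each team is in at most one game. This bounds the days
of the arbitrary schedules `A` and `B` when the games of the whole tournament are counted. -/
theorem IsDoubleRoundRobin.two_mul_card_le {T : Finset V} {s : Schedule V}
    (hs : IsDoubleRoundRobin T s) {d : ℕ} (hd : d < numDays T) : 2 * (s d).card ≤ T.card := by
  classical
  calc 2 * (s d).card = ∑ g ∈ s d, (T.filter fun v => g.1 = v ∨ g.2 = v).card := by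
        rw [mul_comm, ← smul_eq_mul, ← Finset.sum_const]
        refine Finset.sum_congr rfl fun g hg => ?_
        obtain ⟨h1, h2, hne⟩ := hs.mem_teams d hd g hg
        rw [← Finset.card_pair hne]
        congr 1
        ext v
        simp only [Finset.mem_insert, Finset.mem_singleton, Finset.mem_filter]
        constructor
        · rintro (rfl | rfl) <;> simp [h1, h2]
        · rintro ⟨-, rfl | rfl⟩ <;> simp
    _ = ∑ v ∈ T, ((s d).filter fun g => g.1 = v ∨ g.2 = v).card := by
        simp only [Finset.card_filter]
        exact Finset.sum_comm
    _ ≤ ∑ _v ∈ T, 1 := by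
        refine Finset.sum_le_sum fun v hv => Finset.card_le_one.2 fun g hg g' hg' => ?_
        exact (hs.one_game_a_day d hd v hv).unique (Finset.mem_filter.1 hg)
          (Finset.mem_filter.1 hg')
    _ = T.card := by simp

/-- A feasible schedule remains feasible when the teams are renamed. -/
theorem IsFeasible.of_bijOn {W : Type*} {k : ℕ} {T : Finset W} {s : Schedule W}
    (hs : IsFeasible k T s) {T' : Finset V} {s' : Schedule V} (φ : V → W)
    (hφ : Set.BijOn φ (T' : Set V) (T : Set W))
    (hs' : ∀ d < numDays T, ∀ a b,
      (a, b) ∈ s' d ↔ a ∈ T' ∧ b ∈ T' ∧ (φ a, φ b) ∈ s d) :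
    IsFeasible k T' s' := by
  have hcard : T'.card = T.card := Finset.card_nbij φ hφ.mapsTo hφ.injOn hφ.surjOn
  have hdays : numDays T' = numDays T := by rw [numDays, numDays, hcard]
  obtain ⟨⟨hmem, hone, hgame⟩, hrep, hbd⟩ := hs
  have hmaps : ∀ {v}, v ∈ T' → φ v ∈ T := fun hv => hφ.mapsTo hv
  refine ⟨⟨?_, ?_, ?_⟩, ?_, ?_⟩
  · rintro d hd ⟨a, b⟩ hg
    rw [hdays] at hd
    obtain ⟨ha, hb, hg⟩ := (hs' d hd a b).1 hg
    exact ⟨ha, hb, fun h => (hmem d hd _ hg).2.2 (congrArg φ h)⟩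
  · intro d hd v hv
    rw [hdays] at hd
    obtain ⟨⟨x, y⟩, ⟨hg, hv'⟩, huniq⟩ := hone d hd (φ v) (hmaps hv)
    obtain ⟨hx, hy, -⟩ := hmem d hd _ hg
    obtain ⟨a, ha, rfl⟩ := hφ.surjOn hx
    obtain ⟨b, hb, rfl⟩ := hφ.surjOn hy
    refine ⟨(a, b), ⟨(hs' d hd a b).2 ⟨ha, hb, hg⟩, ?_⟩, ?_⟩
    · exact hv'.imp (fun h => hφ.injOn ha hv h) (fun h => hφ.injOn hb hv h)
    · rintro ⟨a', b'⟩ ⟨hg', hv''⟩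
      obtain ⟨ha', hb', hg'⟩ := (hs' d hd a' b').1 hg'
      have := huniq (φ a', φ b') ⟨hg', hv''.imp (congrArg φ) (congrArg φ)⟩
      rw [Prod.mk.injEq] at this
      rw [hφ.injOn ha' ha this.1, hφ.injOn hb' hb this.2]
  · intro a ha b hb hab
    rw [hdays]
    obtain ⟨d, ⟨hd, hg⟩, huniq⟩ := hgame _ (hmaps ha) _ (hmaps hb)
      fun h => hab (hφ.injOn ha hb h)
    refine ⟨d, ⟨hd, (hs' d hd a b).2 ⟨ha, hb, hg⟩⟩, ?_⟩
    rintro d' ⟨hd', hg'⟩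
    exact huniq d' ⟨hd', ((hs' d' hd' a b).1 hg').2.2⟩
  · intro d hd a b hab
    rw [hdays] at hd
    have hab := ((hs' d (by omega) a b).1 hab).2.2
    obtain ⟨h1, h2⟩ := hrep d hd _ _ hab
    exact ⟨fun h => h1 ((hs' _ hd a b).1 h).2.2, fun h => h2 ((hs' _ hd b a).1 h).2.2⟩
  · intro v hv d hd
    rw [hdays] at hd
    obtain ⟨h1, h2⟩ := hbd (φ v) (hmaps hv) d hd
    refine ⟨fun h => h1 fun i hi => ?_, fun h => h2 fun i hi => ?_⟩
    · obtain ⟨a, ha⟩ := h i hi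
      exact ⟨φ a, ((hs' _ (by omega) a v).1 ha).2.2⟩
    · obtain ⟨a, ha⟩ := h i hi
      exact ⟨φ a, ((hs' _ (by omega) v a).1 ha).2.2⟩

end Criterion

theorem mem_rev {D : Finset (ℕ × ℕ)} {g : ℕ × ℕ} : g ∈ rev D ↔ g.swap ∈ D := by
  rw [rev, Finset.mem_image]
  constructor
  · rintro ⟨g, hg, rfl⟩
    simpa using hg
  · exact fun hg => ⟨_, hg, Prod.swap_swap g⟩

theorem plays_rev {D : Finset (ℕ × ℕ)} {v : ℕ} {b : Bool} : Plays (rev D) v b ↔ Plays D v !b := by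
  cases b <;> simp [Plays, mem_rev]

theorem card_rev_le (D : Finset (ℕ × ℕ)) : (rev D).card ≤ D.card := Finset.card_image_le

section Circle

/-! ### Feasible schedules of TTP-2 by the circle method -/

/-- The day `l < 2h - 1` of a single round-robin of the teams `0, …, 2h - 1` by the circle
method. -/
def circleDay (h l : ℕ) : Finset (ℕ × ℕ) :=
  (Finset.range h).image fun c =>
    if c = 0 then (if l % 2 = 0 then (l, 2 * h - 1) else (2 * h - 1, l))
    else
      let x := if l + c < 2 * h - 1 then l + c else l + c - (2 * h - 1)
      let y := if c ≤ l then l - c else l + (2 * h - 1) - c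
      if c % 2 = 0 then (x, y) else (y, x)

/-- The day of the single round-robin that is played on day `d` of the double round-robin. -/
def circleIndex (h d : ℕ) : ℕ :=
  if d < 2 * h - 1 then d else if d + 1 < 2 * (2 * h - 1) then d + 1 - (2 * h - 1) else 0

/-- A double round-robin of `2h` teams: the days `0, …, 2h - 2` of the circle method, and then the
days `1, …, 2h - 2, 0` with venues reversed. -/
def circleSchedule (h : ℕ) : Schedule ℕ := fun d =>
  if d < 2 * h - 1 then circleDay h d else rev (circleDay h (circleIndex h d))

/-- Team `x` plays away on the day `l` of the single round-robin. -/
def circleAway (h x l : ℕ) : Prop :=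
  if x = 2 * h - 1 then l % 2 = 1
  else if x = l then l % 2 = 0
  else if l < x then (x - l) % 2 = 0
  else (x + (2 * h - 1) - l) % 2 = 0

open Classical in
/-- Whether team `x` plays away on day `d` of the double round-robin. -/
noncomputable def circleVenue (h x d : ℕ) : Bool :=
  if d < 2 * h - 1 then decide (circleAway h x d) else !decide (circleAway h x (circleIndex h d))

theorem circleIndex_lt {h d : ℕ} (hh : 3 ≤ h) : circleIndex h d < 2 * h - 1 := by
  unfold circleIndex
  split_ifs <;> omega

theorem card_circleSchedule_le (h d : ℕ) : (circleSchedule h d).card ≤ h := by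
  have hc : ∀ l, (circleDay h l).card ≤ h := fun l =>
    Finset.card_image_le.trans (Finset.card_range h).le
  unfold circleSchedule
  split_ifs
  · exact hc _
  · exact (card_rev_le _).trans (hc _)

theorem mirrorClosed_circleSchedule {h : ℕ} (hh : 3 ≤ h) :
    MirrorClosed (2 * (2 * h - 1)) (circleSchedule h) := by
  intro d hd g hg
  by_cases hdM : d < 2 * h - 1
  · rw [circleSchedule, if_pos hdM] at hg
    rcases Nat.eq_zero_or_pos d with rfl | hpos
    · refine ⟨2 * (2 * h - 1) - 1, by omega, by omega, ?_⟩
      have : circleIndex h (2 * (2 * h - 1) - 1) = 0 := by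
        unfold circleIndex
        split_ifs <;> omega
      rw [circleSchedule, if_neg (by omega), this, mem_rev, Prod.swap_swap]
      exact hg
    · refine ⟨d + (2 * h - 1) - 1, by omega, by omega, ?_⟩
      have : circleIndex h (d + (2 * h - 1) - 1) = d := by
        unfold circleIndex
        split_ifs <;> omega
      rw [circleSchedule, if_neg (by omega), this, mem_rev, Prod.swap_swap]
      exact hg
  · rw [circleSchedule, if_neg hdM, mem_rev] at hg
    have := @circleIndex_lt h d hh
    refine ⟨circleIndex h d, by omega, by omega, ?_⟩
    rwa [circleSchedule, if_pos this]

theorem meets_circleSchedule {h : ℕ} (hh : 3 ≤ h) {a b : ℕ} (ha : a < b) (hb : b < 2 * h) :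
    Meets (2 * (2 * h - 1)) (circleSchedule h) a b := by
  have key : ∀ l < 2 * h - 1, ((a, b) ∈ circleDay h l ∨ (b, a) ∈ circleDay h l) →
      Meets (2 * (2 * h - 1)) (circleSchedule h) a b := by
    intro l hl hmem
    refine ⟨l, by omega, ?_⟩
    rwa [circleSchedule, if_pos hl]
  by_cases hbM : b = 2 * h - 1
  · refine key a (by omega) ?_
    simp only [circleDay, Finset.mem_image, Finset.mem_range]
    rcases Nat.mod_two_eq_zero_or_one a with h0 | h1
    · exact Or.inl ⟨0, by omega, by simp [h0, hbM]⟩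
    · exact Or.inr ⟨0, by omega, by simp [h1, hbM]⟩
  have main : ∀ l c x y, l < 2 * h - 1 → 0 < c → c < h →
      (if l + c < 2 * h - 1 then l + c else l + c - (2 * h - 1)) = x →
      (if c ≤ l then l - c else l + (2 * h - 1) - c) = y →
      ((x, y) ∈ circleDay h l ∨ (y, x) ∈ circleDay h l) := by
    intro l c x y _ hc hch hx hy
    simp only [circleDay, Finset.mem_image, Finset.mem_range]
    rcases Nat.mod_two_eq_zero_or_one c with h0 | h1
    · exact Or.inl ⟨c, hch, by rw [if_neg hc.ne', if_pos h0, hx, hy]⟩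
    · exact Or.inr ⟨c, hch, by rw [if_neg hc.ne', if_neg (by omega), hx, hy]⟩
  rcases Nat.mod_two_eq_zero_or_one (b - a) with h0 | h1
  · exact key (a + (b - a) / 2) (by omega) (main _ ((b - a) / 2) b a (by omega) (by omega)
      (by omega) (by split_ifs <;> omega) (by split_ifs <;> omega)).symm
  · by_cases hw : b + (2 * h - 1 - (b - a)) / 2 < 2 * h - 1
    · exact key (b + (2 * h - 1 - (b - a)) / 2) (by omega)
        (main _ ((2 * h - 1 - (b - a)) / 2) a b (by omega) (by omega)
        (by omega) (by split_ifs <;> omega) (by split_ifs <;> omega))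
    · exact key (b + (2 * h - 1 - (b - a)) / 2 - (2 * h - 1)) (by omega)
        (main _ ((2 * h - 1 - (b - a)) / 2) a b (by omega) (by omega)
        (by omega) (by split_ifs <;> omega) (by split_ifs <;> omega))

-- With c the offset x - l modulo 2h - 1, team x is paired by c if c < h and by 2h - 1 - c
-- otherwise. As 2h - 1 is odd, switching between the two changes both the parity and the side of
-- the pair, so in either case x is away exactly when c is even.
open Classical in
theorem plays_circleDay {h l x : ℕ} (hl : l < 2 * h - 1) (hx : x < 2 * h) :
    Plays (circleDay h l) x (decide (circleAway h x l)) := by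
  have key : ∀ c y, c < h → ((if c = 0 then (if l % 2 = 0 then (l, 2 * h - 1) else (2 * h - 1, l))
      else
        let x := if l + c < 2 * h - 1 then l + c else l + c - (2 * h - 1)
        let y := if c ≤ l then l - c else l + (2 * h - 1) - c
        if c % 2 = 0 then (x, y) else (y, x)) =
          if circleAway h x l then (x, y) else (y, x)) →
      Plays (circleDay h l) x (decide (circleAway h x l)) := by
    intro c y hc hmem
    refine ⟨y, ?_⟩
    simp only [decide_eq_true_eq]
    rw [← hmem]
    exact Finset.mem_image_of_mem _ (Finset.mem_range.2 hc)
  by_cases hxM : x = 2 * h - 1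
  · refine key 0 l (by omega) ?_
    simp only [circleAway, if_pos hxM, if_true]
    split_ifs <;> first | omega | simp [hxM]
  by_cases hxl : x = l
  · refine key 0 (2 * h - 1) (by omega) ?_
    subst hxl
    simp only [circleAway, if_neg hxM, if_true]
  set c := if l < x then x - l else x + (2 * h - 1) - l with hc
  have haway : circleAway h x l ↔ c % 2 = 0 := by
    simp only [circleAway, if_neg hxM, if_neg hxl, hc]
    split_ifs <;> rfl
  have hc0 : 0 < c ∧ c < 2 * h - 1 := by
    rw [hc]
    split_ifs <;> omega
  simp only [haway] at key ⊢
  by_cases hch : c < h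
  · refine key c (if c ≤ l then l - c else l + (2 * h - 1) - c) hch ?_
    have : (if l + c < 2 * h - 1 then l + c else l + c - (2 * h - 1)) = x := by
      rw [hc]
      split_ifs <;> omega
    simp only [if_neg hc0.1.ne', this]
  · set e := 2 * h - 1 - c with he
    refine key e (if l + e < 2 * h - 1 then l + e else l + e - (2 * h - 1)) (by omega) ?_
    have : (if e ≤ l then l - e else l + (2 * h - 1) - e) = x := by
      rw [he, hc]
      split_ifs <;> omega
    simp only [if_neg (show e ≠ 0 by omega), this]
    by_cases h0 : c % 2 = 0
    · rw [if_pos h0, if_neg (by omega)]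
    · rw [if_neg h0, if_pos (by omega)]

theorem plays_circleSchedule {h d x : ℕ} (hh : 3 ≤ h) (hx : x < 2 * h) :
    Plays (circleSchedule h d) x (circleVenue h x d) := by
  unfold circleSchedule circleVenue
  split_ifs with hd
  · exact plays_circleDay hd hx
  · rw [plays_rev, Bool.not_not]
    exact plays_circleDay (circleIndex_lt hh) hx

/-- The offset x - l modulo 2h - 1 drops by one each day, so venues alternate except where it passes
0. There the game against team 2h - 1, whose venue depends on the parity of l, leaves exactly one
break, before or after day x. -/
theorem eq_of_circleAway_succ {h x l : ℕ} (hl : l + 1 < 2 * h - 1)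
    (hb : circleAway h x (l + 1) ↔ circleAway h x l) :
    x = l ∧ x % 2 = 0 ∨ x = l + 1 ∧ x % 2 = 1 := by
  unfold circleAway at hb
  split_ifs at hb <;> omega

theorem eq_of_circleAway_zero {h x : ℕ} (hx : x < 2 * h) (hh : 3 ≤ h)
    (hb : circleAway h x 0 ↔ circleAway h x (2 * h - 2)) :
    x = 2 * h - 2 ∨ x = 2 * h - 1 := by
  unfold circleAway at hb
  split_ifs at hb <;> omega

/-- This is the seam between the two halves. Going from day 2h - 2 to day 1 changes the offset by
two, so the reversal of venues makes them alternate; starting the second half with day 0 would give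
nearly every team a break here. -/
theorem eq_of_circleAway_one {h x : ℕ} (hx : x < 2 * h) (hh : 3 ≤ h)
    (hb : ¬ circleAway h x 1 ↔ circleAway h x (2 * h - 2)) :
    x = 0 ∨ x = 1 ∨ x = 2 * h - 2 ∨ x = 2 * h - 1 := by
  unfold circleAway at hb
  split_ifs at hb <;> omega

/-- Three equal venues mean two adjacent breaks. The preceding lemmas name the few teams that can
have a break at a given step, and no team appears at two neighbouring steps. The cases are the
position of the three days relative to the seam and to the final day, which is day 0 reversed. -/
theorem noRun_circleVenue {h x : ℕ} (hh : 3 ≤ h) (hx : x < 2 * h) :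
    NoRun 2 (2 * (2 * h - 1)) (circleVenue h x) := by
  intro d hd
  by_contra! hcon
  have h1 := hcon 1 (by omega)
  have h2 := (hcon 2 (by omega)).trans h1.symm
  have hv1 : ∀ d, d < 2 * h - 1 → (circleVenue h x d = true ↔ circleAway h x d) := by
    intro d hd
    simp [circleVenue, hd]
  have hv2 : ∀ d l, 2 * h - 1 ≤ d → circleIndex h d = l → (circleVenue h x d = true ↔
      ¬ circleAway h x l) := by
    rintro d _ hd rfl
    simp [circleVenue, hd]
  have hi1 : ∀ d, 2 * h - 1 ≤ d → d + 1 < 2 * (2 * h - 1) →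
      circleIndex h d = d + 1 - (2 * h - 1) := by
    intro d hd hd'
    rw [circleIndex, if_neg (by omega), if_pos hd']
  rw [Bool.eq_iff_iff] at h1 h2
  by_cases c1 : d + 2 < 2 * h - 1
  · rw [hv1 _ (by omega), hv1 _ (by omega)] at h1 h2
    have := eq_of_circleAway_succ (by omega) h1
    have := eq_of_circleAway_succ c1 h2
    omega
  by_cases c2 : 2 * h - 1 ≤ d
  · obtain ⟨l, hl⟩ : ∃ l, d + 1 - (2 * h - 1) = l := ⟨_, rfl⟩
    rw [hv2 (d + 1) (l + 1) (by omega) (by rw [hi1 _ (by omega) (by omega)]; omega),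
      hv2 d l (by omega) (by rw [hi1 _ (by omega) (by omega)]; omega), not_iff_not] at h1
    have b1 := eq_of_circleAway_succ (by omega) h1
    by_cases c3 : d + 3 < 2 * (2 * h - 1)
    · rw [hv2 (d + 2) (l + 2) (by omega) (by rw [hi1 _ (by omega) (by omega)]; omega),
        hv2 (d + 1) (l + 1) (by omega) (by rw [hi1 _ (by omega) (by omega)]; omega),
        not_iff_not] at h2
      have := eq_of_circleAway_succ (by omega) h2
      omega
    · rw [hv2 (d + 2) 0 (by omega) (by rw [circleIndex, if_neg (by omega), if_neg (by omega)]),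
        hv2 (d + 1) (2 * h - 2) (by omega) (by rw [hi1 _ (by omega) (by omega)]; omega),
        not_iff_not] at h2
      have := eq_of_circleAway_zero hx hh h2
      omega
  by_cases c3 : d + 1 < 2 * h - 1
  · rw [hv1 _ (by omega), hv1 _ (by omega)] at h1
    rw [hv2 (d + 2) 1 (by omega) (by rw [hi1 _ (by omega) (by omega)]; omega),
      hv1 _ (by omega), show d + 1 = 2 * h - 2 by omega] at h2
    have := eq_of_circleAway_succ (by omega) h1
    have := eq_of_circleAway_one hx hh h2
    omega
  · rw [hv2 (d + 1) 1 (by omega) (by rw [hi1 _ (by omega) (by omega)]; omega),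
      hv1 _ (by omega), show d = 2 * h - 2 by omega] at h1
    rw [hv2 (d + 2) 2 (by omega) (by rw [hi1 _ (by omega) (by omega)]; omega),
      hv2 (d + 1) 1 (by omega) (by rw [hi1 _ (by omega) (by omega)]; omega), not_iff_not] at h2
    have := eq_of_circleAway_one hx hh h1
    have := eq_of_circleAway_succ (by omega) h2
    omega

theorem isFeasible_circleSchedule {h : ℕ} (hh : 3 ≤ h) :
    IsFeasible 2 (Finset.range (2 * h)) (circleSchedule h) := by
  have hdays : numDays (Finset.range (2 * h)) = 2 * (2 * h - 1) := by
    rw [numDays, Finset.card_range]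
  refine isFeasible_of_plays (Finset.card_range _) (fun d _ => card_circleSchedule_le h d) ?_ ?_ ?_
  · rw [hdays]
    exact mirrorClosed_circleSchedule hh
  · intro a ha b hb hab
    rw [Finset.mem_range] at ha hb
    rw [hdays]
    rcases lt_or_gt_of_ne hab with hlt | hlt
    · exact meets_circleSchedule hh hlt hb
    · exact (meets_circleSchedule hh hlt ha).symm
  · intro v hv
    rw [Finset.mem_range] at hv
    refine ⟨circleVenue h v, fun d _ => plays_circleSchedule hh hv, ?_⟩
    rw [hdays]
    exact noRun_circleVenue hh hv

/-- There are feasible schedules of TTP-2 for every even number of teams from 6 on. -/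
theorem exists_isFeasible_two_Ico {a b h : ℕ} (hh : 3 ≤ h) (hab : a + 2 * h = b) :
    ∃ s, IsFeasible 2 (Finset.Ico a b) s := by
  refine ⟨fun d => (Finset.Ico a b ×ˢ Finset.Ico a b).filter fun g =>
    (g.1 - a, g.2 - a) ∈ circleSchedule h d,
    (isFeasible_circleSchedule hh).of_bijOn (fun x => x - a) ⟨?_, ?_, ?_⟩ ?_⟩
  · intro x hx
    simp only [Finset.coe_Ico, Set.mem_Ico, Finset.coe_range, Set.mem_Iio] at hx ⊢
    omega
  · intro x hx y hy hxy
    simp only [Finset.coe_Ico, Set.mem_Ico] at hx hy hxy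
    omega
  · intro x hx
    simp only [Finset.coe_range, Set.mem_Iio] at hx
    refine ⟨x + a, ?_, by simp⟩
    simp only [Finset.coe_Ico, Set.mem_Ico]
    omega
  · intro d _ x y
    simp [Finset.mem_filter, Finset.mem_product, and_assoc]

end Circle

/-- The double round-robins needed for the leftover games exist. -/
theorem exists_isLeftoverChoice {k m : ℕ} (hk : 3 ≤ k) (hm : 1 ≤ m) (r : ℕ) :
    ∃ A B, IsLeftoverChoice k m r A B := by
  obtain ⟨A, hA⟩ := exists_isFeasible_two_Ico (a := 2 * k * (m - 1)) (b := 2 * k * m + 2 * r)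
    (h := k + r) (by omega) (by obtain ⟨m, rfl⟩ := Nat.exists_eq_add_of_le' hm; simp; ring)
  have hB : ∀ U, ∃ B, IsFeasible 2 (superTeam k U) B := fun U =>
    exists_isFeasible_two_Ico (h := k) hk (by ring)
  choose B hB using hB
  exact ⟨A, B, hA, fun U _ => hB U⟩

/-! ### Listing the teams along the cycle packing -/

theorem cycleGraph_adj_of_succ {k : ℕ} (hk : 3 ≤ k) {u v : Fin k}
    (h : (v : ℕ) = ((u : ℕ) + 1) % k) : (SimpleGraph.cycleGraph k).Adj u v := by
  rw [SimpleGraph.cycleGraph_adj']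
  right
  rw [Fin.sub_def]
  have hu := u.2
  simp only [h]
  rcases Nat.lt_or_ge ((u : ℕ) + 1) k with hlt | hge
  · rw [Nat.mod_eq_of_lt hlt, show k - (u : ℕ) + ((u : ℕ) + 1) = 1 + k by omega,
      Nat.add_mod_right, Nat.mod_eq_of_lt (by omega)]
  · rw [show (u : ℕ) + 1 = k by omega, Nat.mod_self, add_zero, show k - (u : ℕ) = 1 by omega,
      Nat.mod_eq_of_lt (by omega)]

/-- The vertices of a cycle packing can be listed cycle by cycle. -/
theorem IsCyclePacking.exists_equiv {k c : ℕ} (hk : 3 ≤ k) {W : Type*} [Fintype W]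
    {P : SimpleGraph W} (hP : IsCyclePacking k P) (hW : Fintype.card W = c * k) :
    ∃ e : W ≃ Fin c × Fin k, ∀ x y, (e x).1 = (e y).1 →
      ((e y).2 : ℕ) = ((e x).2 + 1) % k → P.Adj x y := by
  classical
  let f := fun C => (hP C).some
  -- Split the vertices by component and number each component by its isomorphism with the k-cycle;
  -- comparing cardinalities then gives c components.
  let e₁ : W ≃ P.ConnectedComponent × Fin k :=
    ((Equiv.sigmaFiberEquiv P.connectedComponentMk).symm.trans
      (Equiv.sigmaCongrRight fun C => (f C).toEquiv)).trans (Equiv.sigmaEquivProd _ _)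
  have : Fintype P.ConnectedComponent := Fintype.ofFinite _
  have hcard : Fintype.card P.ConnectedComponent = c := by
    have h1 := Fintype.card_congr e₁
    rw [hW, Fintype.card_prod, Fintype.card_fin] at h1
    exact (Nat.eq_of_mul_eq_mul_right (by omega) h1).symm
  refine ⟨e₁.trans ((Fintype.equivFinOfCardEq hcard).prodCongr (Equiv.refl _)), ?_⟩
  intro x y h1 h2
  have h1 : P.connectedComponentMk x = P.connectedComponentMk y :=
    (Fintype.equivFinOfCardEq hcard).injective h1
  have hx : ∀ C (hC : P.connectedComponentMk x = C), (e₁ x).2 = f C ⟨x, hC⟩ := by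
    rintro _ rfl
    rfl
  have hy : (e₁ y).2 = f _ ⟨y, rfl⟩ := rfl
  have h2 : ((e₁ y).2 : ℕ) = ((e₁ x).2 + 1) % k := h2
  rw [hx _ h1, hy] at h2
  have := (f _).map_adj_iff.1 (cycleGraph_adj_of_succ hk h2)
  exact this

/-- The teams can be listed in accordance with the cycle packing. -/
theorem exists_isLabelling {V : Type*} [Fintype V] {k m n : ℕ} (hk : 3 ≤ k)
    (hV : Fintype.card V = n) {S : Finset V} (hS : S.card = 2 * m * k) {P : SimpleGraph S}
    (hP : IsCyclePacking k P) : ∃ t : Fin n ≃ V, IsLabelling k m S P t := by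
  classical
  obtain ⟨e, he⟩ := hP.exists_equiv (c := 2 * m) hk (by rw [Fintype.card_coe, hS])
  have hn : 2 * m * k ≤ n := by
    rw [← hS, ← hV]
    exact Finset.card_le_univ S
  -- `finProdFinEquiv` sends (i, j) to j + k * i, so quotient and remainder by k recover the cycle
  -- and the place in it.
  let e' : {v // v ∈ S} ≃ {a : Fin n // (a : ℕ) < 2 * m * k} :=
    (e.trans finProdFinEquiv).trans
      ⟨fun a => ⟨⟨a, a.2.trans_le hn⟩, a.2⟩, fun a => ⟨a.1, a.2⟩, fun _ => rfl, fun _ => rfl⟩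
  have he' : ∀ x, ((e' x).1 : ℕ) = (e x).2 + k * (e x).1 := fun _ => rfl
  let c : V ≃ Fin n := Fintype.equivFinOfCardEq hV
  -- The teams outside S may be listed arbitrarily; their number matches that of the remaining
  -- labels.
  obtain ⟨g⟩ : Nonempty ({v // ¬ v ∈ S} ≃ {a : Fin n // ¬ (a : ℕ) < 2 * m * k}) :=
    ⟨Fintype.equivOfCardEq (by
      rw [Fintype.card_subtype_compl, Fintype.card_subtype_compl, Fintype.card_congr e',
        Fintype.card_congr c])⟩
  let T : V ≃ Fin n :=
    (Equiv.sumCompl _).symm.trans ((Equiv.sumCongr e' g).trans (Equiv.sumCompl _))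
  have hT : ∀ v (hv : v ∈ S), T v = (e' ⟨v, hv⟩).1 := by
    intro v hv
    simp [T, Equiv.sumCompl_symm_apply_of_pos hv]
  have hT' : ∀ v, v ∉ S → ¬ ((T v : ℕ) < 2 * m * k) := by
    intro v hv
    have : T v = (g ⟨v, hv⟩).1 := by
      simp [T, Equiv.sumCompl_symm_apply_of_neg hv]
    rw [this]
    exact (g ⟨v, hv⟩).2
  refine ⟨T.symm, ?_, ?_⟩
  · intro a
    obtain ⟨v, rfl⟩ := T.surjective a
    rw [Equiv.symm_apply_apply]
    constructor
    · intro hv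
      rw [hT v hv]
      exact (e' ⟨v, hv⟩).2
    · exact fun hlt => by_contra fun hv => hT' v hv hlt
  · intro a b ha hb h1 h2
    have ha' : ((a : ℕ)) = (e ⟨_, ha⟩).2 + k * (e ⟨_, ha⟩).1 := by
      rw [← he', ← hT _ ha, Equiv.apply_symm_apply]
    have hb' : ((b : ℕ)) = (e ⟨_, hb⟩).2 + k * (e ⟨_, hb⟩).1 := by
      rw [← he', ← hT _ hb, Equiv.apply_symm_apply]
    have hlt : ∀ x, ((e x).2 : ℕ) / k = 0 := fun x => Nat.div_eq_of_lt (e x).2.2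
    rw [ha', hb', Nat.add_mul_div_left _ _ (by omega), Nat.add_mul_div_left _ _ (by omega),
      hlt, hlt] at h1
    rw [ha', hb', Nat.add_mul_mod_self_left, Nat.add_mul_mod_self_left,
      Nat.mod_eq_of_lt (e _).2.2, Nat.mod_eq_of_lt (e _).2.2] at h2
    exact he _ _ (Fin.ext (by omega)) h2

section Combine

/-! ### Combining schedules -/

variable {V : Type*}

/-- Mirror closure asks only for some suitable day, so parts can be combined without conditions at
their borders: each part contains its own reversals, and repetitions across parts are excluded later
by counting. -/
theorem MirrorClosed.union [DecidableEq V] {L : ℕ} {s t : Schedule V} (hs : MirrorClosed L s)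
    (ht : MirrorClosed L t) : MirrorClosed L fun d => s d ∪ t d := by
  intro d hd g hg
  rcases Finset.mem_union.1 hg with hg | hg
  · obtain ⟨d', hd', hne, hmem⟩ := hs d hd g hg
    exact ⟨d', hd', hne, Finset.mem_union_left _ hmem⟩
  · obtain ⟨d', hd', hne, hmem⟩ := ht d hd g hg
    exact ⟨d', hd', hne, Finset.mem_union_right _ hmem⟩

theorem MirrorClosed.biUnion {ι : Type*} [DecidableEq V] {L : ℕ} {I : Finset ι}
    {s : ι → Schedule V} (hs : ∀ i ∈ I, MirrorClosed L (s i)) :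
    MirrorClosed L fun d => I.biUnion fun i => s i d := by
  intro d hd g hg
  obtain ⟨i, hi, hg⟩ := Finset.mem_biUnion.1 hg
  obtain ⟨d', hd', hne, hmem⟩ := hs i hi d hd g hg
  exact ⟨d', hd', hne, Finset.mem_biUnion.2 ⟨i, hi, hmem⟩⟩

theorem MirrorClosed.append {L L' : ℕ} {s t : Schedule V} (hs : MirrorClosed L s)
    (ht : MirrorClosed L' t) :
    MirrorClosed (L + L') fun d => if d < L then s d else t (d - L) := by
  intro d hd g hg
  dsimp only at hg
  split_ifs at hg with h
  · obtain ⟨d', hd', hne, hmem⟩ := hs d h g hg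
    exact ⟨d', by omega, hne, by simpa only [if_pos hd'] using hmem⟩
  · obtain ⟨d', hd', hne, hmem⟩ := ht (d - L) (by omega) g hg
    refine ⟨L + d', by omega, by omega, ?_⟩
    simpa only [if_neg (show ¬ L + d' < L by omega), Nat.add_sub_cancel_left] using hmem

theorem MirrorClosed.blocks {L c : ℕ} {s : ℕ → Schedule V}
    (hs : ∀ q < c, MirrorClosed L (s q)) :
    MirrorClosed (L * c) fun d => s (d / L) (d % L) := by
  intro d hd g hg
  have hL : 0 < L := Nat.pos_of_ne_zero fun h => by simp [h] at hd
  have hq : d / L < c := Nat.div_lt_of_lt_mul hd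
  obtain ⟨d', hd', hne, hmem⟩ := hs _ hq _ (Nat.mod_lt d hL) g hg
  have hdiv := Nat.div_add_mod d L
  refine ⟨L * (d / L) + d', ?_, by omega, ?_⟩
  · calc L * (d / L) + d' < L * (d / L + 1) := by rw [mul_add]; omega
      _ ≤ L * c := Nat.mul_le_mul_left L hq
  · dsimp only
    rwa [Nat.mul_add_div hL, Nat.div_eq_of_lt hd', Nat.mul_add_mod, Nat.mod_eq_of_lt hd', add_zero]

theorem Meets.congr {L : ℕ} {s t : Schedule V} {a b : V} (hs : Meets L s a b)
    (h : ∀ d < L, s d ⊆ t d) : Meets L t a b := by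
  obtain ⟨d, hd, hm⟩ := hs
  exact ⟨d, hd, hm.imp (fun hm => h d hd hm) (fun hm => h d hd hm)⟩

theorem Meets.append_left {L L' : ℕ} {s t : Schedule V} {a b : V} (hs : Meets L s a b) :
    Meets (L + L') (fun d => if d < L then s d else t (d - L)) a b := by
  obtain ⟨d, hd, hm⟩ := hs
  exact ⟨d, by omega, by simpa only [if_pos hd] using hm⟩

theorem Meets.append_right {L L' : ℕ} {s t : Schedule V} {a b : V} (ht : Meets L' t a b) :
    Meets (L + L') (fun d => if d < L then s d else t (d - L)) a b := by
  obtain ⟨d, hd, hm⟩ := ht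
  refine ⟨L + d, by omega, ?_⟩
  simpa only [if_neg (show ¬ L + d < L by omega), Nat.add_sub_cancel_left] using hm

theorem Meets.blocks {L c q : ℕ} {s : ℕ → Schedule V} {a b : V} (hq : q < c)
    (hs : Meets L (s q) a b) : Meets (L * c) (fun d => s (d / L) (d % L)) a b := by
  obtain ⟨d, hd, hm⟩ := hs
  refine ⟨L * q + d, ?_, ?_⟩
  · calc L * q + d < L * (q + 1) := by rw [mul_add]; omega
      _ ≤ L * c := Nat.mul_le_mul_left L hq
  · dsimp only
    rwa [Nat.mul_add_div (by omega), Nat.div_eq_of_lt hd, Nat.mul_add_mod, Nat.mod_eq_of_lt hd,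
      add_zero]

end Combine

section Games

/-! ### Cycle-games and super-games -/

/-- The venues of a team in a super-game: `b` on the first `k` days, then `!b`, and so on, but with
venues reversed on the day `σ` of each block of `k` days. -/
def venue (k σ : ℕ) (b : Bool) (d : ℕ) : Bool :=
  (b ^^ decide (d / k % 2 = 1)) ^^ decide (d % k = σ)

theorem venue_block {k σ : ℕ} (b : Bool) {j i : ℕ} (hi : i < k) :
    venue k σ b (k * j + i) = ((b ^^ decide (j % 2 = 1)) ^^ decide (i = σ)) := by
  rw [venue, Nat.mul_add_div (by omega), Nat.div_eq_of_lt hi, Nat.mul_add_mod,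
    Nat.mod_eq_of_lt hi, add_zero]

theorem venue_two_mul_add {k σ : ℕ} (b : Bool) (d : ℕ) :
    venue k σ b (2 * k + d) = venue k σ b d := by
  rcases Nat.eq_zero_or_pos k with rfl | hk
  · simp
  · have h1 : (2 * k + d) / k = d / k + 2 := by
      rw [add_comm, mul_comm, Nat.add_mul_div_left _ _ hk]
    have h2 : (2 * k + d) % k = d % k := by
      rw [mul_comm, Nat.mul_add_mod]
    rw [venue, venue, h1, h2, Nat.add_mod_right]

theorem mirrorClosed_mirrored {k : ℕ} (hk : 2 ≤ k) (e : Schedule ℕ) :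
    MirrorClosed (2 * k) (mirrored k e) := by
  intro d hd g hg
  rw [mirrored] at hg
  split_ifs at hg with h
  · refine ⟨k + d, by omega, by omega, ?_⟩
    rwa [mirrored, if_neg (by omega), Nat.add_sub_cancel_left, mem_rev, Prod.swap_swap]
  · refine ⟨d - k, by omega, by omega, ?_⟩
    rwa [mirrored, if_pos (by omega), ← mem_rev]

/-- The source of the words `venue`: a team with constant venue b except on day σ of the first half
has the opposite pattern in the second half. With σ = k there is no exceptional day. -/
theorem plays_mirrored {k σ : ℕ} {e : Schedule ℕ} {v : ℕ} {b : Bool}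
    (h : ∀ l < k, Plays (e l) v (b ^^ decide (l = σ))) {d : ℕ} (hd : d < 2 * k) :
    Plays (mirrored k e d) v (venue k σ b d) := by
  rw [mirrored]
  split_ifs with hdk
  · have := venue_block (σ := σ) b (j := 0) hdk
    rw [mul_zero, zero_add] at this
    simpa [this] using h d hdk
  · obtain ⟨l, rfl⟩ := Nat.exists_eq_add_of_le (not_lt.1 hdk)
    have := venue_block (σ := σ) b (j := 1) (i := l) (k := k) (by omega)
    rw [mul_one] at this
    rw [this, plays_rev, Nat.add_sub_cancel_left]
    simpa using h l (by omega)

theorem card_mirrored_le {k c : ℕ} {e : Schedule ℕ} (he : ∀ l, (e l).card ≤ c) (d : ℕ) :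
    (mirrored k e d).card ≤ c := by
  rw [mirrored]
  split_ifs
  · exact he d
  · exact (card_rev_le _).trans (he _)

theorem meets_mirrored {k a b l : ℕ} {e : Schedule ℕ} (hl : l < k)
    (h : (a, b) ∈ e l ∨ (b, a) ∈ e l) : Meets (2 * k) (mirrored k e) a b :=
  ⟨l, by omega, by rwa [mirrored, if_pos hl]⟩

/-- What is needed of a game of `L` days in which the teams of `X`, away on the first day, meet
those of `Y`, except for the pairs not in `R`. -/
structure IsBlockGame (k σ L c : ℕ) (X Y : Finset ℕ) (R : ℕ → ℕ → Prop) (s : Schedule ℕ) :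
    Prop where
  away : ∀ v ∈ X, ∀ d < L, Plays (s d) v (venue k σ true d)
  home : ∀ v ∈ Y, ∀ d < L, Plays (s d) v (venue k σ false d)
  mirror : MirrorClosed L s
  card_le : ∀ d, (s d).card ≤ c
  meets : ∀ x ∈ X, ∀ y ∈ Y, R x y → Meets L s x y

theorem card_cycleDay_le (k a b l : ℕ) : (cycleDay k a b l).card ≤ k :=
  Finset.card_image_le.trans (Finset.card_range k).le

theorem exists_add_mod_eq {k : ℕ} {i j : ℕ} (hi : i < k) (hj : j < k) :
    ∃ l < k, (i + l) % k = j := by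
  rcases le_or_gt i j with h | h
  · exact ⟨j - i, by omega, by rw [Nat.add_sub_cancel' h, Nat.mod_eq_of_lt hj]⟩
  · exact ⟨j + k - i, by omega,
      by rw [Nat.add_sub_cancel' (by omega), Nat.add_mod_right, Nat.mod_eq_of_lt hj]⟩

theorem plays_cycleDay_away {k a i : ℕ} (hi : i < k) (b l : ℕ) :
    Plays (cycleDay k a b l) (k * a + i) true :=
  ⟨_, Finset.mem_image_of_mem _ (Finset.mem_range.2 hi)⟩

theorem plays_cycleDay_home {k b j : ℕ} (hj : j < k) (a l : ℕ) :
    Plays (cycleDay k a b l) (k * b + j) false := by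
  obtain ⟨i, hi, hij⟩ := exists_add_mod_eq (Nat.mod_lt l (by omega)) hj
  refine ⟨k * a + i, Finset.mem_image.2 ⟨i, Finset.mem_range.2 hi, ?_⟩⟩
  rw [Nat.mod_add_mod, add_comm] at hij
  simp [hij]

/-- The teams of cycle-team `a`. -/
def cycleTeam (k a : ℕ) : Finset ℕ := Finset.Ico (k * a) (k * (a + 1))

theorem mem_cycleTeam {k a v : ℕ} : v ∈ cycleTeam k a ↔ ∃ i < k, k * a + i = v := by
  rw [cycleTeam, Finset.mem_Ico, mul_add, mul_one]
  constructor
  · rintro ⟨h1, h2⟩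
    exact ⟨v - k * a, by omega, by omega⟩
  · rintro ⟨i, hi, rfl⟩
    omega

theorem isBlockGame_mirrored_cycleDay {k σ : ℕ} (hk : 2 ≤ k) (a b : ℕ) {e : Schedule ℕ}
    (he : ∀ l < k, e l = if l = σ then rev (cycleDay k a b l) else cycleDay k a b l)
    (he' : ∀ l, (e l).card ≤ k) :
    IsBlockGame k σ (2 * k) k (cycleTeam k a) (cycleTeam k b) (fun _ _ => True)
      (mirrored k e) := by
  have hplays : ∀ v c, (∀ l, Plays (cycleDay k a b l) v c) →
      ∀ d < 2 * k, Plays (mirrored k e d) v (venue k σ c d) := by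
    intro v c h d hd
    refine plays_mirrored (fun l hl => ?_) hd
    rw [he l hl]
    split_ifs with hσ
    · simpa [plays_rev, hσ] using h σ
    · simpa [hσ] using h l
  refine ⟨?_, ?_, mirrorClosed_mirrored hk _, card_mirrored_le he', ?_⟩
  · intro v hv
    obtain ⟨i, hi, rfl⟩ := mem_cycleTeam.1 hv
    exact hplays _ _ fun l => plays_cycleDay_away hi b l
  · intro v hv
    obtain ⟨i, hi, rfl⟩ := mem_cycleTeam.1 hv
    exact hplays _ _ fun l => plays_cycleDay_home hi a l
  · intro x hx y hy _
    obtain ⟨i, hi, rfl⟩ := mem_cycleTeam.1 hx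
    obtain ⟨j, hj, rfl⟩ := mem_cycleTeam.1 hy
    obtain ⟨l, hl, hij⟩ := exists_add_mod_eq hi hj
    refine meets_mirrored hl ?_
    have hmem : (k * a + i, k * b + j) ∈ cycleDay k a b l := by
      rw [← hij]
      exact Finset.mem_image.2 ⟨i, Finset.mem_range.2 hi, rfl⟩
    rw [he l hl]
    split_ifs
    · exact Or.inr (mem_rev.2 hmem)
    · exact Or.inl hmem

theorem isBlockGame_normalCycleGame {k : ℕ} (hk : 2 ≤ k) (a b : ℕ) :
    IsBlockGame k k (2 * k) k (cycleTeam k a) (cycleTeam k b) (fun _ _ => True)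
      (normalCycleGame k a b) :=
  isBlockGame_mirrored_cycleDay hk a b (fun l hl => by rw [if_neg hl.ne])
    (card_cycleDay_le k a b)

theorem isBlockGame_leftCycleGame {k : ℕ} (hk : 2 ≤ k) (a b : ℕ) :
    IsBlockGame k (k - 1) (2 * k) k (cycleTeam k a) (cycleTeam k b) (fun _ _ => True)
      (leftCycleGame k a b) := by
  refine isBlockGame_mirrored_cycleDay hk a b (fun l hl => rfl) fun l => ?_
  split_ifs
  · exact (card_rev_le _).trans (card_cycleDay_le k a b l)
  · exact card_cycleDay_le k a b l

theorem superTeam_eq (k U : ℕ) :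
    superTeam k U = cycleTeam k (2 * U) ∪ cycleTeam k (2 * U + 1) := by
  ext v
  simp only [superTeam, cycleTeam, Finset.mem_union, Finset.mem_Ico]
  have e1 : 2 * k * U = k * (2 * U) := by ring
  have e2 : 2 * k * (U + 1) = k * (2 * U) + k + k := by ring
  have e3 : k * (2 * U + 1) = k * (2 * U) + k := by ring
  have e4 : k * (2 * U + 1 + 1) = k * (2 * U) + k + k := by ring
  rw [e1, e2, e3, e4]
  omega

theorem mem_superTeam {k U v : ℕ} : v ∈ superTeam k U ↔ ∃ j < 2 * k, 2 * k * U + j = v := by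
  rw [superTeam, Finset.mem_Ico, mul_add, mul_one]
  constructor
  · rintro ⟨h1, h2⟩
    exact ⟨v - 2 * k * U, by omega, by omega⟩
  · rintro ⟨i, hi, rfl⟩
    omega

/-- Each of the four pairs of cycle-teams is served in one of the two sub-slots. A sub-slot is two
blocks long, the period of `venue`, so the pattern simply continues into the second one. -/
theorem isBlockGame_superGame {k σ : ℕ} {game : ℕ → ℕ → Schedule ℕ}
    (hg : ∀ a b, IsBlockGame k σ (2 * k) k (cycleTeam k a) (cycleTeam k b) (fun _ _ => True)
      (game a b)) (U W : ℕ) :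
    IsBlockGame k σ (4 * k) (2 * k) (superTeam k U) (superTeam k W) (fun _ _ => True)
      (superGame k game U W) := by
  have hL : 4 * k = 2 * k + 2 * k := by ring
  have hplays : ∀ v b, (∀ d < 2 * k,
      Plays (game (2 * U) (2 * W) d ∪ game (2 * U + 1) (2 * W + 1) d) v (venue k σ b d)) →
      (∀ d < 2 * k,
      Plays (game (2 * U) (2 * W + 1) d ∪ game (2 * U + 1) (2 * W) d) v (venue k σ b d)) →
      ∀ d < 4 * k, Plays (superGame k game U W d) v (venue k σ b d) := by
    intro v b h1 h2 d hd
    rw [superGame]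
    split_ifs with h
    · exact h1 d h
    · obtain ⟨l, rfl⟩ := Nat.exists_eq_add_of_le (not_lt.1 h)
      rw [venue_two_mul_add, Nat.add_sub_cancel_left]
      exact h2 l (by omega)
  refine ⟨?_, ?_, ?_, ?_, ?_⟩
  · intro v hv
    rw [superTeam_eq, Finset.mem_union] at hv
    rcases hv with hv | hv
    · exact hplays _ _
        (fun d hd => ((hg _ _).away v hv d hd).mono Finset.subset_union_left)
        (fun d hd => ((hg _ _).away v hv d hd).mono Finset.subset_union_left)
    · exact hplays _ _
        (fun d hd => ((hg _ _).away v hv d hd).mono Finset.subset_union_right)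
        (fun d hd => ((hg _ _).away v hv d hd).mono Finset.subset_union_right)
  · intro v hv
    rw [superTeam_eq, Finset.mem_union] at hv
    rcases hv with hv | hv
    · exact hplays _ _
        (fun d hd => ((hg _ _).home v hv d hd).mono Finset.subset_union_left)
        (fun d hd => ((hg _ _).home v hv d hd).mono Finset.subset_union_right)
    · exact hplays _ _
        (fun d hd => ((hg _ _).home v hv d hd).mono Finset.subset_union_right)
        (fun d hd => ((hg _ _).home v hv d hd).mono Finset.subset_union_left)
  · rw [hL]
    exact ((hg _ _).mirror.union (hg _ _).mirror).append ((hg _ _).mirror.union (hg _ _).mirror)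
  · intro d
    have h2 : ∀ a b a' b' d d', (game a b d ∪ game a' b' d').card ≤ 2 * k := by
      intro a b a' b' d d'
      have := (hg a b).card_le d
      have := (hg a' b').card_le d'
      have := Finset.card_union_le (game a b d) (game a' b' d')
      omega
    rw [superGame]
    split_ifs <;> exact h2 ..
  · intro x hx y hy _
    rw [hL]
    rw [superTeam_eq, Finset.mem_union] at hx hy
    rcases hx with hx | hx <;> rcases hy with hy | hy
    · exact (((hg _ _).meets x hx y hy trivial).congr
        fun d _ => Finset.subset_union_left).append_left
        (t := fun d => game (2 * U) (2 * W + 1) d ∪ game (2 * U + 1) (2 * W) d)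
    · exact (((hg _ _).meets x hx y hy trivial).congr
        fun d _ => Finset.subset_union_left).append_right
    · exact (((hg _ _).meets x hx y hy trivial).congr
        fun d _ => Finset.subset_union_right).append_right
    · exact (((hg _ _).meets x hx y hy trivial).congr
        fun d _ => Finset.subset_union_right).append_left
        (t := fun d => game (2 * U) (2 * W + 1) d ∪ game (2 * U + 1) (2 * W) d)

theorem mem_insert_superTeam {k U e v : ℕ} :
    v ∈ insert e (superTeam k U) ↔ ∃ i ≤ 2 * k, extended k U e i = v := by
  rw [Finset.mem_insert, mem_superTeam]
  constructor
  · rintro (rfl | ⟨j, hj, rfl⟩)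
    · exact ⟨2 * k, le_rfl, by simp [extended]⟩
    · exact ⟨j, hj.le, by simp [extended, hj.ne]⟩
  · rintro ⟨i, hi, rfl⟩
    rcases hi.eq_or_lt with rfl | hi
    · simp [extended]
    · exact Or.inr ⟨i, hi, by simp [extended, hi.ne]⟩

theorem mod_eq_of_eq_add {x j M : ℕ} (hj : j < M) (h : x = j ∨ x = j + M ∨ x = j + M + M) :
    x % M = j := by
  rcases h with rfl | rfl | rfl
  · exact Nat.mod_eq_of_lt hj
  · rw [Nat.add_mod_right, Nat.mod_eq_of_lt hj]
  · rw [Nat.add_mod_right, Nat.add_mod_right, Nat.mod_eq_of_lt hj]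

/-- The three alternatives are the congruence 2l ≡ i + j modulo 2k + 1, spelled out in a form
accessible to `omega`. -/
theorem mem_rightDay {k i j l : ℕ} (U e W f : ℕ) (hi : i ≤ 2 * k) (hj : j ≤ 2 * k)
    (h : 2 * l = i + j ∨ 2 * l = i + j + (2 * k + 1) ∨ 2 * l + (2 * k + 1) = i + j) :
    (extended k U e i, extended k W f j) ∈ rightDay k U e W f l := by
  refine Finset.mem_image.2 ⟨i, Finset.mem_range.2 (by omega), ?_⟩
  rw [mod_eq_of_eq_add (j := j) (by omega) (by omega)]

theorem card_rightDay_le (k U e W f l : ℕ) : (rightDay k U e W f l).card ≤ 2 * k + 1 :=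
  Finset.card_image_le.trans (Finset.card_range _).le

theorem plays_rightDay_away {k i l : ℕ} (U e W f : ℕ) (hi : i ≤ 2 * k) :
    Plays (rightDay k U e W f l) (extended k U e i) true :=
  ⟨_, Finset.mem_image_of_mem _ (Finset.mem_range.2 (by omega))⟩

theorem plays_rightDay_home {k j l : ℕ} (U e W f : ℕ) (hj : j ≤ 2 * k) (hl : l < 2 * k) :
    Plays (rightDay k U e W f l) (extended k W f j) false := by
  by_cases h1 : 2 * l < j
  · exact ⟨_, mem_rightDay (i := 2 * l + (2 * k + 1) - j) U e W f (by omega) hj (by omega)⟩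
  by_cases h2 : 2 * l ≤ 2 * k + j
  · exact ⟨_, mem_rightDay (i := 2 * l - j) U e W f (by omega) hj (by omega)⟩
  · exact ⟨_, mem_rightDay (i := 2 * l - j - (2 * k + 1)) U e W f (by omega) hj (by omega)⟩

/-- Days 0, …, 2k - 1 omit only day 2k, whose index sums are congruent to 4k ≡ 2k - 1 modulo 2k + 1.
These are i = j = 2k (the two extra teams) and i + j = 2k - 1, whence the excluded pairs; the sum of
labels expresses the latter. -/
theorem isBlockGame_rightSuperGame {k : ℕ} (hk : 3 ≤ k) (U e W f : ℕ) :
    IsBlockGame k (k - 2) (4 * k) (2 * k + 1) (insert e (superTeam k U))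
      (insert f (superTeam k W))
      (fun x y => ¬ (x = e ∧ y = f) ∧ (x ∈ superTeam k U → y ∈ superTeam k W →
        x + y ≠ 2 * k * U + 2 * k * W + (2 * k - 1))) (rightSuperGame k U e W f) := by
  have hL : 4 * k = 2 * k + 2 * k := by ring
  have hplays : ∀ v b, (∀ l < 2 * k, Plays (rightDay k U e W f l) v b) →
      ∀ d < 4 * k, Plays (rightSuperGame k U e W f d) v (venue k (k - 2) b d) := by
    intro v b h
    have key : ∀ s ≤ k, ∀ d < 2 * k,
        Plays (rightHalf k U e W f s d) v (venue k (k - 2) b d) := by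
      intro s hs d hd
      refine plays_mirrored (fun l hl => ?_) hd
      have := h (s + l) (by omega)
      split_ifs with hσ
      · simpa [plays_rev, hσ] using this
      · simpa [hσ] using this
    intro d hd
    rw [rightSuperGame]
    split_ifs with hdk
    · exact key 0 (by omega) d hdk
    · obtain ⟨l, rfl⟩ := Nat.exists_eq_add_of_le (not_lt.1 hdk)
      rw [venue_two_mul_add, Nat.add_sub_cancel_left]
      exact key k le_rfl l (by omega)
  refine ⟨?_, ?_, ?_, ?_, ?_⟩
  · intro v hv
    obtain ⟨i, hi, rfl⟩ := mem_insert_superTeam.1 hv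
    exact hplays _ _ fun l _ => plays_rightDay_away U e W f hi
  · intro v hv
    obtain ⟨j, hj, rfl⟩ := mem_insert_superTeam.1 hv
    exact hplays _ _ fun l hl => plays_rightDay_home U e W f hj hl
  · rw [hL]
    exact (mirrorClosed_mirrored (by omega) _).append (mirrorClosed_mirrored (by omega) _)
  · intro d
    have key : ∀ s d, (rightHalf k U e W f s d).card ≤ 2 * k + 1 := by
      intro s d
      refine card_mirrored_le (fun l => ?_) d
      split_ifs
      · exact (card_rev_le _).trans (card_rightDay_le ..)
      · exact card_rightDay_le ..
    rw [rightSuperGame]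
    split_ifs <;> exact key ..
  · rintro x hx y hy ⟨hxy, hsum⟩
    obtain ⟨i, hi, rfl⟩ := mem_insert_superTeam.1 hx
    obtain ⟨j, hj, rfl⟩ := mem_insert_superTeam.1 hy
    have h1 : ¬ (i = 2 * k ∧ j = 2 * k) := by
      rintro ⟨rfl, rfl⟩
      exact hxy (by simp [extended])
    have h2 : i + j ≠ 2 * k - 1 := by
      intro h
      have hi' : i ≠ 2 * k := by omega
      have hj' : j ≠ 2 * k := by omega
      simp only [extended, if_neg hi', if_neg hj'] at hsum
      exact hsum (mem_superTeam.2 ⟨i, by omega, rfl⟩) (mem_superTeam.2 ⟨j, by omega, rfl⟩)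
        (by omega)
    -- Half of i + j modulo the odd number 2k + 1; the value l = 2k is ruled out by `h1` and `h2`.
    obtain ⟨l, hl, hlij⟩ : ∃ l < 2 * k,
        2 * l = i + j ∨ 2 * l = i + j + (2 * k + 1) ∨ 2 * l + (2 * k + 1) = i + j := by
      rcases Nat.mod_two_eq_zero_or_one (i + j) with h0 | h0
      · exact ⟨(i + j) / 2, by omega, by omega⟩
      · by_cases hlt : i + j < 2 * k
        · exact ⟨(i + j + (2 * k + 1)) / 2, by omega, by omega⟩
        · exact ⟨(i + j - (2 * k + 1)) / 2, by omega, by omega⟩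
    have hmem := mem_rightDay U e W f hi hj hlij
    have key : ∀ s l, l < k → (extended k U e i, extended k W f j) ∈ rightDay k U e W f (s + l) →
        Meets (2 * k) (rightHalf k U e W f s) (extended k U e i) (extended k W f j) := by
      intro s l hl hmem
      refine meets_mirrored hl ?_
      split_ifs
      · exact Or.inr (mem_rev.2 hmem)
      · exact Or.inl hmem
    rw [hL]
    rcases lt_or_ge l k with hlk | hlk
    · exact (key 0 l hlk (by rwa [zero_add])).append_left
    · exact (key k (l - k) (by omega) (by rwa [Nat.add_sub_cancel' hlk])).append_right

end Games

section Slots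

/-! ### Columns and time slots -/

theorem IsBlockGame.mono {k σ L c : ℕ} {X Y : Finset ℕ} {R R' : ℕ → ℕ → Prop} {s : Schedule ℕ}
    (hs : IsBlockGame k σ L c X Y R s) (hR : ∀ x y, R' x y → R x y) :
    IsBlockGame k σ L c X Y R' s :=
  ⟨hs.away, hs.home, hs.mirror, hs.card_le, fun x hx y hy h => hs.meets x hx y hy (hR x y h)⟩

/-- The day of each block of `k` days on which the game of column `c` in slot `q` has its venues
reversed (`k` if there is none). -/
def columnShift (k m r q c : ℕ) : ℕ :=
  if m / 2 ≤ c + r then k - 2 else if c = 0 ∨ q = m - 2 then k - 1 else k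

/-- Whether the upper super-team of column `c` plays away in slot `q`. -/
def upperAway (δ : Bool) (q c : ℕ) : Bool := decide ((c + q) % 2 = 0 ↔ δ = true)

/-- The team-pair in column `c`, if there is one, consists of this team and the next one. -/
def pairTeam (k m c : ℕ) : ℕ := 2 * k * m + 2 * (m / 2 - 1 - c)

/-- The teams of the upper side of column `c` in slot `q`. -/
def upperTeams (k m r q c : ℕ) : Finset ℕ :=
  if m / 2 ≤ c + r then insert (pairTeam k m c) (superTeam k (upper m q c))
  else superTeam k (upper m q c)

/-- The teams of the lower side of column `c` in slot `q`. -/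
def lowerTeams (k m r q c : ℕ) : Finset ℕ :=
  if m / 2 ≤ c + r then insert (pairTeam k m c + 1) (superTeam k (lower m q c))
  else superTeam k (lower m q c)

/-- The game between the team `x` of the upper and the team `y` of the lower side of column `c` is
played in slot `q`. -/
def ColumnMeets (k m r q c x y : ℕ) : Prop :=
  m / 2 ≤ c + r → ¬ (x = pairTeam k m c ∧ y = pairTeam k m c + 1) ∧
    (x ∈ superTeam k (upper m q c) → y ∈ superTeam k (lower m q c) →
      x + y ≠ 2 * k * upper m q c + 2 * k * lower m q c + (2 * k - 1))

/-- Separates direction from position: the condition for meeting is symmetric in the two sides, so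
the alternating direction only decides which side takes the away role. -/
theorem isBlockGame_columnGame {k : ℕ} (hk : 3 ≤ k) (m r : ℕ) (δ : Bool) (q c : ℕ) :
    (upperAway δ q c = true ∧ IsBlockGame k (columnShift k m r q c) (4 * k)
      (2 * k + if m / 2 ≤ c + r then 1 else 0) (upperTeams k m r q c) (lowerTeams k m r q c)
      (ColumnMeets k m r q c) (columnGame k m r δ q c)) ∨
    (upperAway δ q c = false ∧ IsBlockGame k (columnShift k m r q c) (4 * k)
      (2 * k + if m / 2 ≤ c + r then 1 else 0) (lowerTeams k m r q c) (upperTeams k m r q c)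
      (fun y x => ColumnMeets k m r q c x y) (columnGame k m r δ q c)) := by
  by_cases hr : m / 2 ≤ c + r
  · by_cases hδ : (c + q) % 2 = 0 ↔ δ = true
    · refine Or.inl ⟨decide_eq_true hδ, ?_⟩
      simp only [columnShift, upperTeams, lowerTeams, columnGame, if_pos hr, if_pos hδ]
      exact (isBlockGame_rightSuperGame hk _ _ _ _).mono fun x y h => h hr
    · refine Or.inr ⟨decide_eq_false hδ, ?_⟩
      simp only [columnShift, upperTeams, lowerTeams, columnGame, if_pos hr, if_neg hδ]
      refine (isBlockGame_rightSuperGame hk _ _ _ _).mono fun y x h => ?_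
      obtain ⟨h1, h2⟩ := h hr
      refine ⟨fun h => h1 h.symm, fun hy hx => ?_⟩
      have := h2 hx hy
      rwa [add_comm y x, add_comm (2 * k * lower m q c)]
  · have hgame : ∀ a b, IsBlockGame k (columnShift k m r q c) (2 * k) k (cycleTeam k a)
        (cycleTeam k b) (fun _ _ => True)
        ((if c = 0 ∨ q = m - 2 then leftCycleGame k else normalCycleGame k) a b) := by
      intro a b
      rw [columnShift, if_neg hr]
      split_ifs
      · exact isBlockGame_leftCycleGame (by omega) a b
      · exact isBlockGame_normalCycleGame (by omega) a b
    by_cases hδ : (c + q) % 2 = 0 ↔ δ = true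
    · refine Or.inl ⟨decide_eq_true hδ, ?_⟩
      simp only [upperTeams, lowerTeams, columnGame, if_neg hr, if_pos hδ]
      exact (isBlockGame_superGame hgame _ _).mono fun _ _ _ => trivial
    · refine Or.inr ⟨decide_eq_false hδ, ?_⟩
      simp only [upperTeams, lowerTeams, columnGame, if_neg hr, if_neg hδ]
      exact (isBlockGame_superGame hgame _ _).mono fun _ _ _ => trivial

theorem columnGame_subset_slot {k m r : ℕ} {δ : Bool} {q c : ℕ} (hc : c < m / 2) (d : ℕ) :
    columnGame k m r δ q c d ⊆ slot k m r δ q d :=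
  Finset.subset_biUnion_of_mem (fun c => columnGame k m r δ q c d) (Finset.mem_range.2 hc)

theorem plays_slot_upper {k m r : ℕ} (hk : 3 ≤ k) (δ : Bool) {q c v d : ℕ} (hc : c < m / 2)
    (hv : v ∈ upperTeams k m r q c) (hd : d < 4 * k) :
    Plays (slot k m r δ q d) v (venue k (columnShift k m r q c) (upperAway δ q c) d) := by
  refine Plays.mono (columnGame_subset_slot hc d) ?_
  rcases isBlockGame_columnGame hk m r δ q c with ⟨h, hg⟩ | ⟨h, hg⟩ <;> rw [h]
  · exact hg.away v hv d hd
  · exact hg.home v hv d hd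

theorem plays_slot_lower {k m r : ℕ} (hk : 3 ≤ k) (δ : Bool) {q c v d : ℕ} (hc : c < m / 2)
    (hv : v ∈ lowerTeams k m r q c) (hd : d < 4 * k) :
    Plays (slot k m r δ q d) v (venue k (columnShift k m r q c) (!upperAway δ q c) d) := by
  refine Plays.mono (columnGame_subset_slot hc d) ?_
  rcases isBlockGame_columnGame hk m r δ q c with ⟨h, hg⟩ | ⟨h, hg⟩ <;> rw [h]
  · exact hg.home v hv d hd
  · exact hg.away v hv d hd

theorem mirrorClosed_slot {k : ℕ} (hk : 3 ≤ k) (m r : ℕ) (δ : Bool) (q : ℕ) :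
    MirrorClosed (4 * k) (slot k m r δ q) := by
  refine MirrorClosed.biUnion (s := columnGame k m r δ q) fun c _ => ?_
  rcases isBlockGame_columnGame hk m r δ q c with ⟨-, hg⟩ | ⟨-, hg⟩ <;> exact hg.mirror

theorem card_slot_le {k : ℕ} (hk : 3 ≤ k) (m r : ℕ) (δ : Bool) (q d : ℕ) :
    (slot k m r δ q d).card ≤ m / 2 * (2 * k) + r := by
  calc (slot k m r δ q d).card
      ≤ ∑ c ∈ Finset.range (m / 2), (columnGame k m r δ q c d).card := Finset.card_biUnion_le
    _ ≤ ∑ c ∈ Finset.range (m / 2), (2 * k + if m / 2 ≤ c + r then 1 else 0) := by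
        refine Finset.sum_le_sum fun c _ => ?_
        rcases isBlockGame_columnGame hk m r δ q c with ⟨-, hg⟩ | ⟨-, hg⟩ <;> exact hg.card_le d
    _ = m / 2 * (2 * k) + ((Finset.range (m / 2)).filter fun c => m / 2 ≤ c + r).card := by
        rw [Finset.sum_add_distrib, Finset.card_filter]
        simp
    _ ≤ m / 2 * (2 * k) + r := by
        refine Nat.add_le_add_left ?_ _
        calc _ ≤ (Finset.Ico (m / 2 - r) (m / 2)).card := by
              refine Finset.card_le_card fun c hc => ?_
              simp only [Finset.mem_filter, Finset.mem_range, Finset.mem_Ico] at hc ⊢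
              omega
          _ ≤ r := by
              rw [Nat.card_Ico]
              omega

theorem meets_slot {k m r : ℕ} (hk : 3 ≤ k) (δ : Bool) {q c x y : ℕ} (hc : c < m / 2)
    (hx : x ∈ upperTeams k m r q c) (hy : y ∈ lowerTeams k m r q c)
    (hxy : ColumnMeets k m r q c x y) : Meets (4 * k) (slot k m r δ q) x y := by
  refine Meets.congr ?_ fun d _ => columnGame_subset_slot hc d
  rcases isBlockGame_columnGame hk m r δ q c with ⟨-, hg⟩ | ⟨-, hg⟩
  · exact hg.meets x hx y hy hxy
  · exact (hg.meets y hy x hx hxy).symm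

theorem superTeam_subset_upperTeams (k m r q c : ℕ) :
    superTeam k (upper m q c) ⊆ upperTeams k m r q c := by
  unfold upperTeams
  split_ifs
  · exact Finset.subset_insert _ _
  · exact subset_rfl

theorem superTeam_subset_lowerTeams (k m r q c : ℕ) :
    superTeam k (lower m q c) ⊆ lowerTeams k m r q c := by
  unfold lowerTeams
  split_ifs
  · exact Finset.subset_insert _ _
  · exact subset_rfl

/-! ### The rotation of the super-teams -/

/-- The position of the super-team `U < m - 1` in slot `q < m - 1`. -/
def position (m q U : ℕ) : ℕ := if U + q < m - 1 then U + q else U + q - (m - 1)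

theorem atPosition_position {m q U : ℕ} (hq : q < m - 1) (hU : U < m - 1) :
    atPosition m q (position m q U) = U := by
  unfold atPosition position
  split_ifs <;> exact mod_eq_of_eq_add hU (by omega)

theorem exists_atPosition_eq {m p U : ℕ} (hp : p < m - 1) (hU : U < m - 1) :
    ∃ q < m - 1, atPosition m q p = U := by
  unfold atPosition
  rcases le_or_gt U p with h | h
  · exact ⟨p - U, by omega, mod_eq_of_eq_add hU (by omega)⟩
  · exact ⟨p + (m - 1) - U, by omega, mod_eq_of_eq_add hU (by omega)⟩

theorem upper_of_pos {m q c : ℕ} (hc : 0 < c) : upper m q c = atPosition m q (c - 1) :=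
  if_neg hc.ne'

/-- The positions c - 1 and m - 2 - c differ by m - 1 - 2c, and the common rotation preserves
differences. For a right column this is 2i + 1 with i its team-pair, the shift used in the leftover
days. -/
theorem lower_eq_upper_add {m q c : ℕ} (hm : m % 2 = 0) (hq : q < m - 1) (hc : 0 < c)
    (hcm : c < m / 2) :
    lower m q c = (upper m q c + (2 * (m / 2 - 1 - c) + 1)) % (m - 1) := by
  rw [upper_of_pos hc, lower, atPosition, atPosition, Nat.mod_add_mod]
  congr 1
  omega

theorem exists_upper_lower_of_eq {m c U W : ℕ} (hm : m % 2 = 0) (hc : 0 < c) (hcm : c < m / 2)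
    (hU : U < m - 1) (hW : W < m - 1) (h : U = W + 2 * c ∨ U + (m - 1) = W + 2 * c) :
    ∃ q < m - 1, upper m q c = U ∧ lower m q c = W := by
  obtain ⟨q, hq, hqU⟩ := exists_atPosition_eq (p := c - 1) (by omega) hU
  rw [← upper_of_pos hc] at hqU
  refine ⟨q, hq, hqU, ?_⟩
  rw [lower_eq_upper_add hm hq hc hcm, hqU]
  exact mod_eq_of_eq_add hW (by omega)

/-- Any two super-teams other than the last one meet in some slot. -/
theorem exists_upper_lower {m U W : ℕ} (hm : m % 2 = 0) (hU : U < m - 1) (hW : W < m - 1)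
    (hUW : U ≠ W) : ∃ q < m - 1, ∃ c, 0 < c ∧ c < m / 2 ∧
      ((upper m q c = U ∧ lower m q c = W) ∨ (upper m q c = W ∧ lower m q c = U)) := by
  have key : ∀ c, 0 < c → c < m / 2 →
      ((U = W + 2 * c ∨ U + (m - 1) = W + 2 * c) ∨ (W = U + 2 * c ∨ W + (m - 1) = U + 2 * c)) →
      ∃ q < m - 1, ∃ c, 0 < c ∧ c < m / 2 ∧
      ((upper m q c = U ∧ lower m q c = W) ∨ (upper m q c = W ∧ lower m q c = U)) := by
    rintro c hc hcm (h | h)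
    · obtain ⟨q, hq, h⟩ := exists_upper_lower_of_eq hm hc hcm hU hW h
      exact ⟨q, hq, c, hc, hcm, Or.inl h⟩
    · obtain ⟨q, hq, h⟩ := exists_upper_lower_of_eq hm hc hcm hW hU h
      exact ⟨q, hq, c, hc, hcm, Or.inr h⟩
  -- With truncated subtraction this is |U - W|. As m - 1 is odd, either it or m - 1 - |U - W| is
  -- even, and half of that one is the column.
  rcases Nat.mod_two_eq_zero_or_one (U - W + (W - U)) with h | h
  · exact key ((U - W + (W - U)) / 2) (by omega) (by omega) (by omega)
  · exact key ((m - 1 - (U - W + (W - U))) / 2) (by omega) (by omega) (by omega)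

/-! ### Venues during the time slots -/

/-- The conditions under which venues `venue k (σ q) (b q)` in the slots `q < m - 1` do not give
long runs. -/
structure IsSlotVenue (k m : ℕ) (σ : ℕ → ℕ) (b : ℕ → Bool) : Prop where
  shift : ∀ q, σ q = k - 2 ∨ σ q = k - 1 ∨ σ q = k
  last : σ (m - 2) ≠ k
  border : ∀ q, q + 1 < m - 1 →
    (σ q ≠ k ∧ σ (q + 1) ≠ k) ∨ b (q + 1) = (b q ^^ decide (σ q = k - 1))

/-- The venues of a team during all time slots. -/
def slotsVenue (k : ℕ) (σ : ℕ → ℕ) (b : ℕ → Bool) (d : ℕ) : Bool :=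
  venue k (σ (d / (4 * k))) (b (d / (4 * k))) (d % (4 * k))

theorem slotsVenue_block {k : ℕ} (σ : ℕ → ℕ) (b : ℕ → Bool) {j i : ℕ} (hi : i < k) :
    slotsVenue k σ b (k * j + i) =
      ((b (j / 4) ^^ decide (j % 2 = 1)) ^^ decide (i = σ (j / 4))) := by
  have h := Nat.div_add_mod j 4
  have h1 : k * j + i = 4 * k * (j / 4) + (k * (j % 4) + i) := by
    conv_lhs => rw [← h]
    ring
  have h2 : k * (j % 4) + i < 4 * k := by
    have : j % 4 ≤ 3 := by omega
    nlinarith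
  rw [slotsVenue, h1, Nat.mul_add_div (by omega), Nat.div_eq_of_lt h2, Nat.mul_add_mod,
    Nat.mod_eq_of_lt h2, add_zero, venue_block _ hi, Nat.mod_mod_of_dvd _ (by norm_num)]

theorem exists_ne_of_ne {k : ℕ} {w : ℕ → Bool} {d x y : ℕ} (hx : d ≤ x) (hx' : x ≤ d + k)
    (hy : d ≤ y) (hy' : y ≤ d + k) (h : w x ≠ w y) : ∃ i ≤ k, w (d + i) ≠ w d := by
  by_contra! hcon
  have h1 := hcon (x - d) (by omega)
  have h2 := hcon (y - d) (by omega)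
  rw [Nat.add_sub_cancel' hx] at h1
  rw [Nat.add_sub_cancel' hy] at h2
  exact h (h1.trans h2.symm)

/-- If a block has a reversed day at all, it is one of the last two, so exactly one of these is
reversed. -/
theorem IsSlotVenue.ne_of_shift {k m : ℕ} (hk : 3 ≤ k) {σ : ℕ → ℕ} {b : ℕ → Bool}
    (h : IsSlotVenue k m σ b) {j : ℕ} (hj : σ (j / 4) ≠ k) :
    slotsVenue k σ b (k * j + (k - 2)) ≠ slotsVenue k σ b (k * j + (k - 1)) := by
  rw [slotsVenue_block _ _ (by omega), slotsVenue_block _ _ (by omega)]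
  have h1 : k - 1 ≠ k - 2 := by omega
  rcases h.shift (j / 4) with h | h | h
  · simp [h, h1]
  · simp [h, h1.symm]
  · exact absurd h hj

theorem IsSlotVenue.noRun {k m : ℕ} (hk : 3 ≤ k) {σ : ℕ → ℕ} {b : ℕ → Bool}
    (h : IsSlotVenue k m σ b) : NoRun k (4 * k * (m - 1)) (slotsVenue k σ b) := by
  intro d hd
  obtain ⟨j, i, hi, rfl⟩ : ∃ j i, i < k ∧ d = k * j + i :=
    ⟨d / k, d % k, Nat.mod_lt _ (by omega), (Nat.div_add_mod d k).symm⟩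
  have hj1 : k * (j + 1) = k * j + k := by ring
  -- Unless d lies in the last block of its slot, d and d + k are in consecutive blocks of the same
  -- slot, at the same place, with opposite venues.
  by_cases hj : j % 4 = 3
  swap
  · refine exists_ne_of_ne (x := k * j + i) (y := k * (j + 1) + i) (by omega) (by omega)
      (by omega) (by omega) ?_
    rw [slotsVenue_block _ _ hi, slotsVenue_block _ _ hi, show (j + 1) / 4 = j / 4 by omega]
    rcases Nat.mod_two_eq_zero_or_one j with h0 | h0
    · simp [h0, show (j + 1) % 2 = 1 by omega]
    · simp [h0, show (j + 1) % 2 = 0 by omega]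
  have hq1 : (j + 1) / 4 = j / 4 + 1 := by omega
  have hq : j / 4 + 1 < m - 1 := by
    have h1 : k * (j + 1) < k * (4 * (m - 1)) := by
      have : k * (4 * (m - 1)) = 4 * k * (m - 1) := by ring
      omega
    have := Nat.lt_of_mul_lt_mul_left h1
    omega
  rcases h.border _ hq with ⟨h1, h2⟩ | hb
  · rcases lt_or_ge i (k - 1) with hik | hik
    · exact exists_ne_of_ne (by omega) (by omega) (by omega) (by omega) (h.ne_of_shift hk h1)
    · rw [← hq1] at h2
      exact exists_ne_of_ne (by omega) (by omega) (by omega) (by omega) (h.ne_of_shift hk h2)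
  · refine exists_ne_of_ne (x := k * j + (k - 1)) (y := k * (j + 1) + 0) (by omega) (by omega)
      (by omega) (by omega) ?_
    rw [slotsVenue_block _ _ (by omega), slotsVenue_block _ _ (by omega), hq1, hb,
      show j % 2 = 1 by omega, show (j + 1) % 2 = 0 by omega]
    -- σ ≥ k - 2 ≥ 1, so the first day of a block is never the reversed one.
    have h0 : (0 : ℕ) ≠ σ (j / 4 + 1) := by
      have := h.shift (j / 4 + 1)
      omega
    simp only [h0, eq_comm (a := k - 1)]
    cases b (j / 4) <;> cases decide (σ (j / 4) = k - 1) <;> simp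

theorem IsSlotVenue.last_ne {k m : ℕ} (hk : 3 ≤ k) (hm : 2 ≤ m) {σ : ℕ → ℕ} {b : ℕ → Bool}
    (h : IsSlotVenue k m σ b) :
    slotsVenue k σ b (4 * k * (m - 1) - 2) ≠ slotsVenue k σ b (4 * k * (m - 1) - 1) := by
  have hj : (4 * (m - 2) + 3) / 4 = m - 2 := by omega
  have := h.ne_of_shift hk (j := 4 * (m - 2) + 3) (by rw [hj]; exact h.last)
  obtain ⟨l, rfl⟩ := Nat.exists_eq_add_of_le' hm
  have h1 : 4 * k * (l + 2 - 1) = k * (4 * (l + 2 - 2) + 3) + k := by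
    simp
    ring
  rw [h1]
  convert this using 2 <;> omega

theorem upperAway_eq {δ : Bool} {q q' c c' : ℕ} (h : (c + q) % 2 = (c' + q') % 2) :
    upperAway δ q c = upperAway δ q' c' := by
  rw [upperAway, upperAway, h]

theorem upperAway_eq_not {δ : Bool} {q q' c c' : ℕ} (h : (c + q) % 2 ≠ (c' + q') % 2) :
    upperAway δ q c = !upperAway δ q' c' := by
  rw [upperAway, upperAway, ← decide_not, decide_eq_decide]
  rcases Nat.mod_two_eq_zero_or_one (c + q) with h1 | h1
  · simp [h1, show (c' + q') % 2 = 1 by omega]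
  · simp [h1, show (c' + q') % 2 = 0 by omega]

/-- Three kinds of team. The last super-team is always in a left game and a pair always in a right
game, so both satisfy the first alternative of `border`. A rotating super-team satisfies the second,
by following its position around the two rows. The bound on r keeps column 0 from being a right
column. -/
theorem exists_isSlotVenue {k m r : ℕ} (hk : 3 ≤ k) (hm : m % 2 = 0) (hm4 : 4 ≤ m) (hr : r < m / 2) (δ : Bool)
    {v : ℕ} (hv : v < 2 * k * m + 2 * r) : ∃ σ b, IsSlotVenue k m σ b ∧
      ∀ q < m - 1, ∀ d < 4 * k, Plays (slot k m r δ q d) v (venue k (σ q) (b q) d) := by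
  have hshift : ∀ q c, columnShift k m r q c = k - 2 ∨ columnShift k m r q c = k - 1 ∨
      columnShift k m r q c = k := by
    intro q c
    unfold columnShift
    split_ifs <;> simp
  have hright : ∀ {q c}, m / 2 ≤ c + r → columnShift k m r q c = k - 2 := fun h => if_pos h
  have hleft : ∀ q, columnShift k m r q 0 = k - 1 := by
    intro q
    rw [columnShift, if_neg (by omega), if_pos (Or.inl rfl)]
  have hlast : ∀ c, columnShift k m r (m - 2) c ≠ k := by
    intro c
    unfold columnShift
    split_ifs with h1 h2
    · omega
    · omega
    · exact absurd (Or.inr rfl) h2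
  by_cases hvm : v < 2 * k * m
  · obtain ⟨U, hU, hvU⟩ : ∃ U < m, v ∈ superTeam k U := by
      refine ⟨v / (2 * k), Nat.div_lt_of_lt_mul hvm, mem_superTeam.2
        ⟨v % (2 * k), Nat.mod_lt _ (by omega), Nat.div_add_mod _ _⟩⟩
    by_cases hUm : U = m - 1
    · refine ⟨fun q => columnShift k m r q 0, fun q => upperAway δ q 0,
        ⟨fun q => hshift q 0, hlast 0, fun q _ => Or.inl ?_⟩, fun q _ d hd => ?_⟩
      · simp only [hleft]
        omega
      · refine plays_slot_upper hk δ (by omega) (superTeam_subset_upperTeams _ _ _ _ _ ?_) hd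
        rwa [upper, if_pos rfl, ← hUm]
    · have hUm : U < m - 1 := by omega
      set p : ℕ → ℕ := fun q => position m q U with hp
      have hplt : ∀ q < m - 1, p q < m - 1 := by
        intro q hq
        simp only [hp, position]
        split_ifs <;> omega
      have hpU : ∀ q < m - 1, atPosition m q (p q) = U := fun q hq =>
        atPosition_position hq hUm
      have hpsucc : ∀ q, q + 1 < m - 1 →
          (p q ≠ m - 2 ∧ p (q + 1) = p q + 1) ∨ (p q = m - 2 ∧ p (q + 1) = 0) := by
        intro q hq
        simp only [hp, position]
        split_ifs <;> omega
      set c : ℕ → ℕ := fun q => if p q + 1 < m / 2 then p q + 1 else m - 2 - p q with hc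
      refine ⟨fun q => columnShift k m r q (c q),
        fun q => if p q + 1 < m / 2 then upperAway δ q (c q) else !upperAway δ q (c q),
        ⟨fun q => hshift _ _, hlast _, fun q hq => Or.inr ?_⟩, fun q hq d hd => ?_⟩
      -- Along a row, column and slot together change parity by an even amount. At the right end the
      -- column stays and the row changes, two flips that cancel. Only from the lower side of column
      -- 0 to the upper side of column 1 is the row change not compensated; there σ = k - 1.
      · rcases hpsucc q hq with ⟨hpq, hp'⟩ | ⟨hpq, hp'⟩
        · have hcq : c q ≠ 0 := by
            have := hplt q (by omega)
            simp only [hc]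
            split_ifs <;> omega
          have hs : columnShift k m r q (c q) ≠ k - 1 := by
            unfold columnShift
            split_ifs <;> omega
          rw [decide_eq_false hs, Bool.xor_false]
          simp only [hc, hp']
          split_ifs with h1 h2 h2
          · exact upperAway_eq (by omega)
          · omega
          · rw [upperAway_eq_not (q' := q) (c' := p q + 1) (by omega), Bool.not_not]
          · have := hplt q (by omega)
            exact congrArg _ (upperAway_eq (by omega))
        · have hcq : c q = 0 := by
            simp only [hc, hpq]
            split_ifs <;> omega
          rw [hcq, decide_eq_true (hleft q), Bool.xor_true, if_pos (by omega), if_neg (by omega),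
            Bool.not_not]
          refine upperAway_eq ?_
          simp only [hc, hp']
          split_ifs <;> omega
      · dsimp only
        have hpq := hplt q hq
        split_ifs with h
        · have hcq : c q = p q + 1 := if_pos h
          refine plays_slot_upper hk δ (by omega) (superTeam_subset_upperTeams _ _ _ _ _ ?_) hd
          rwa [upper_of_pos (by omega), hcq, Nat.add_sub_cancel, hpU q hq]
        · have hcq : c q = m - 2 - p q := if_neg h
          refine plays_slot_lower hk δ (by omega) (superTeam_subset_lowerTeams _ _ _ _ _ ?_) hd
          rwa [lower, hcq, show m - 2 - (m - 2 - p q) = p q by omega, hpU q hq]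
  · obtain ⟨i, hi, hvi⟩ : ∃ i < r, v = 2 * k * m + 2 * i ∨ v = 2 * k * m + 2 * i + 1 :=
      ⟨(v - 2 * k * m) / 2, by omega, by omega⟩
    have hc : m / 2 ≤ m / 2 - 1 - i + r := by omega
    have hpair : pairTeam k m (m / 2 - 1 - i) = 2 * k * m + 2 * i := by
      unfold pairTeam
      omega
    rcases hvi with rfl | rfl
    · refine ⟨fun q => columnShift k m r q (m / 2 - 1 - i),
        fun q => upperAway δ q (m / 2 - 1 - i),
        ⟨fun q => hshift _ _, hlast _, fun q _ => Or.inl ?_⟩, fun q _ d hd => ?_⟩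
      · simp only [hright hc]
        omega
      · refine plays_slot_upper hk δ (by omega) ?_ hd
        rw [upperTeams, if_pos hc, hpair]
        exact Finset.mem_insert_self _ _
    · refine ⟨fun q => columnShift k m r q (m / 2 - 1 - i),
        fun q => !upperAway δ q (m / 2 - 1 - i),
        ⟨fun q => hshift _ _, hlast _, fun q _ => Or.inl ?_⟩, fun q _ d hd => ?_⟩
      · simp only [hright hc]
        omega
      · refine plays_slot_lower hk δ (by omega) ?_ hd
        rw [lowerTeams, if_pos hc, hpair]
        exact Finset.mem_insert_self _ _

end Slots

section Leftover

/-! ### Leftover games -/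

theorem card_leftoverDay_le (k m i z : ℕ) : (leftoverDay k m i z).card ≤ (m - 1) * k :=
  Finset.card_image_le.trans (by rw [Finset.card_product, Finset.card_range, Finset.card_range])

theorem mem_leftoverDay_zero {k m a j : ℕ} (ha : a < m - 1) (hj : j < k) (i : ℕ) :
    (2 * k * a + j, 2 * k * ((a + (2 * i + 1)) % (m - 1)) + (2 * k - 1 - j)) ∈
      leftoverDay k m i 0 :=
  Finset.mem_image.2 ⟨(a, j), by simp [ha, hj], rfl⟩

theorem mem_leftoverDay_one {k m a j : ℕ} (ha : a < m - 1) (hj : j < k) (i : ℕ) :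
    (2 * k * a + (2 * k - 1 - j), 2 * k * ((a + (2 * i + 1)) % (m - 1)) + j) ∈
      leftoverDay k m i 1 :=
  Finset.mem_image.2 ⟨(a, j), by simp [ha, hj], rfl⟩

/-- The shift by 2i + 1 permutes the super-teams, so each is once in the role of a and once in that
of b on every such day: one half of its teams is away, the other at home, and s₂ exchanges the
halves. -/
theorem plays_leftoverDay {k m a j : ℕ} (ha : a < m - 1) (hj : j < 2 * k) (i : ℕ) {z : ℕ}
    (hz : z < 2) :
    Plays (leftoverDay k m i z) (2 * k * a + j) (decide (j < k) ^^ decide (z = 1)) := by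
  obtain ⟨b, hb, hba⟩ : ∃ b < m - 1, (b + (2 * i + 1)) % (m - 1) = a := by
    obtain ⟨b, hb, h⟩ := exists_add_mod_eq (Nat.mod_lt (2 * i + 1) (by omega)) ha
    exact ⟨b, hb, by rwa [Nat.mod_add_mod, add_comm] at h⟩
  rcases lt_or_ge j k with hjk | hjk
  · obtain rfl | rfl : z = 0 ∨ z = 1 := by omega
    · exact ⟨_, by simpa [hjk] using mem_leftoverDay_zero ha hjk i⟩
    · refine ⟨2 * k * b + (2 * k - 1 - j), ?_⟩
      have := mem_leftoverDay_one hb hjk i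
      rw [hba] at this
      simpa [hjk] using this
  · obtain ⟨l, hl, rfl⟩ : ∃ l < k, 2 * k - 1 - l = j := ⟨2 * k - 1 - j, by omega, by omega⟩
    have hjk : ¬ 2 * k - 1 - l < k := by omega
    obtain rfl | rfl : z = 0 ∨ z = 1 := by omega
    · refine ⟨2 * k * b + l, ?_⟩
      have := mem_leftoverDay_zero hb hl i
      rw [hba] at this
      simpa [hjk] using this
    · exact ⟨_, by simpa [hjk] using mem_leftoverDay_one ha hl i⟩

theorem mirrorClosed_leftoverGames (k m r : ℕ) : MirrorClosed (4 * r) (leftoverGames k m) :=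
  MirrorClosed.blocks (s := fun i => mirrored 2 (leftoverDay k m i)) fun _ _ =>
    mirrorClosed_mirrored le_rfl _

theorem plays_leftoverGames {k m a j : ℕ} (ha : a < m - 1) (hj : j < 2 * k) (d : ℕ) :
    Plays (leftoverGames k m d) (2 * k * a + j) (venue 2 1 (decide (j < k)) (d % 4)) :=
  plays_mirrored (fun _ hl => plays_leftoverDay ha hj _ hl) (Nat.mod_lt d (by norm_num))

theorem card_leftoverGames_le (k m d : ℕ) : (leftoverGames k m d).card ≤ (m - 1) * k :=
  card_mirrored_le (fun l => card_leftoverDay_le k m _ l) _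

theorem meets_leftoverGames {k m r i a j : ℕ} (hi : i < r) (ha : a < m - 1) (hj : j < 2 * k) :
    Meets (4 * r) (leftoverGames k m) (2 * k * a + j)
      (2 * k * ((a + (2 * i + 1)) % (m - 1)) + (2 * k - 1 - j)) := by
  refine Meets.blocks (s := fun i => mirrored 2 (leftoverDay k m i)) hi ?_
  rcases lt_or_ge j k with hjk | hjk
  · exact meets_mirrored (k := 2) (l := 0) (by norm_num) (Or.inl (mem_leftoverDay_zero ha hjk i))
  · obtain ⟨l, hl, rfl⟩ : ∃ l < k, 2 * k - 1 - l = j := ⟨2 * k - 1 - j, by omega, by omega⟩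
    rw [show 2 * k - 1 - (2 * k - 1 - l) = l by omega]
    exact meets_mirrored (k := 2) (l := 1) (by norm_num) (Or.inl (mem_leftoverDay_one ha hl i))

theorem leftoverVenue_ne (b : Bool) {d : ℕ} (hd : d % 2 = 0) :
    venue 2 1 b (d % 4) ≠ venue 2 1 b ((d + 1) % 4) := by
  have h : d % 4 = 0 ∨ d % 4 = 2 := by omega
  rcases h with h | h
  · rw [h, show (d + 1) % 4 = 1 by omega]
    cases b <;> decide
  · rw [h, show (d + 1) % 4 = 3 by omega]
    cases b <;> decide

end Leftover

section Runs

/-! ### Joining the venues of consecutive parts -/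

/-- By `hlast` a run crossing the joint has at most one day before it, and by `hinit` at most two
after it: three in all, which k ≥ 3 allows. -/
theorem NoRun.append {k D L : ℕ} {w₁ w₂ : ℕ → Bool} (hk : 3 ≤ k) (h₁ : NoRun k D w₁) (hD : 2 ≤ D)
    (hlast : w₁ (D - 2) ≠ w₁ (D - 1)) (h₂ : NoRun 3 L w₂) (hinit : ∃ i ≤ 2, w₂ i ≠ w₂ 0) :
    NoRun k (D + L) fun d => if d < D then w₁ d else w₂ (d - D) := by
  set w : ℕ → Bool := fun d => if d < D then w₁ d else w₂ (d - D) with hw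
  have hw1 : ∀ d < D, w d = w₁ d := fun d hd => if_pos hd
  have hw2 : ∀ d, w (D + d) = w₂ d := by
    intro d
    simp [hw]
  intro d hd
  rcases lt_or_ge (d + k) D with hdk | hdk
  · obtain ⟨i, hi, hne⟩ := h₁ d hdk
    exact ⟨i, hi, by rwa [hw1 _ (by omega), hw1 _ (by omega)]⟩
  rcases lt_or_ge d (D - 1) with hd1 | hd1
  · refine exists_ne_of_ne (x := D - 2) (y := D - 1) (by omega) (by omega) (by omega) (by omega) ?_
    rwa [hw1 _ (by omega), hw1 _ (by omega)]
  rcases lt_or_ge d D with hd2 | hd2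
  · obtain ⟨i, hi, hne⟩ := hinit
    refine exists_ne_of_ne (x := D + i) (y := D + 0) (by omega) (by omega) (by omega)
      (by omega) ?_
    rwa [hw2, hw2]
  · obtain ⟨e, rfl⟩ := Nat.exists_eq_add_of_le hd2
    obtain ⟨i, hi, hne⟩ := h₂ e (by omega)
    refine ⟨i, by omega, ?_⟩
    rwa [add_assoc, hw2, hw2]

theorem NoRun.mono {k k' L : ℕ} {w : ℕ → Bool} (h : NoRun k L w) (hk : k ≤ k') :
    NoRun k' L w := by
  intro d hd
  obtain ⟨i, hi, hne⟩ := h d (by omega)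
  exact ⟨i, hi.trans hk, hne⟩

theorem NoRun.exists_ne_zero {k L : ℕ} {w : ℕ → Bool} (h : NoRun k L w) (hL : k < L) :
    ∃ i ≤ k, w i ≠ w 0 := by
  simpa using h 0 (by omega)

/-- Each four leftover days have venues b, !b, !b, b, so days 2i and 2i + 1 always differ. A run
into `w` thus has one day before the joint and at most two after it. If r = 0, the initial condition
comes from `w` itself. -/
theorem noRun_leftover_append {L r : ℕ} (b : Bool) {w : ℕ → Bool} (hL : 2 < L)
    (hw : NoRun 2 L w) :
    NoRun 3 (4 * r + L) (fun d => if d < 4 * r then venue 2 1 b (d % 4) else w (d - 4 * r)) ∧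
      ∃ i ≤ 2, (fun d => if d < 4 * r then venue 2 1 b (d % 4) else w (d - 4 * r)) i ≠
        (fun d => if d < 4 * r then venue 2 1 b (d % 4) else w (d - 4 * r)) 0 := by
  set u : ℕ → Bool := fun d => if d < 4 * r then venue 2 1 b (d % 4) else w (d - 4 * r) with hu
  have hu1 : ∀ d < 4 * r, u d = venue 2 1 b (d % 4) := fun d hd => if_pos hd
  have hu2 : ∀ d, u (4 * r + d) = w d := by
    intro d
    simp [hu]
  have heven : ∀ d, d % 2 = 0 → d < 4 * r → u d ≠ u (d + 1) := by
    intro d hd hdr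
    rw [hu1 d hdr, hu1 (d + 1) (by omega)]
    exact leftoverVenue_ne b hd
  have hlate : ∀ d, 4 * r ≤ d + 1 → d + 3 < 4 * r + L → ∃ i ≤ 3, u (d + i) ≠ u d := by
    intro d hd hdL
    obtain ⟨i, hi, hne⟩ := hw (d + 1 - 4 * r) (by omega)
    refine exists_ne_of_ne (x := d + 1 + i) (y := d + 1) (by omega) (by omega) (by omega)
      (by omega) ?_
    rwa [← hu2, ← hu2, ← add_assoc, Nat.add_sub_cancel' hd] at hne
  constructor
  · intro d hd
    by_cases h : 4 * r ≤ d + 1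
    · exact hlate d h hd
    rcases Nat.mod_two_eq_zero_or_one d with h0 | h0
    · exact exists_ne_of_ne (by omega) (by omega) (by omega) (by omega)
        (heven d h0 (by omega))
    · exact exists_ne_of_ne (by omega) (by omega) (by omega) (by omega)
        (heven (d + 1) (by omega) (by omega))
  · rcases Nat.eq_zero_or_pos r with rfl | hr
    · have := hw.exists_ne_zero hL
      simpa [← hu2] using this
    · exact ⟨1, by omega, (heven 0 rfl (by omega)).symm⟩

end Runs

section Assembly

/-! ### The whole schedule -/

variable {k m r : ℕ} {A : Schedule ℕ} {B : ℕ → Schedule ℕ}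

theorem numDays_lastTeams (hm : 1 ≤ m) : numDays (lastTeams k m r) = 2 * (2 * k + 2 * r - 1) := by
  obtain ⟨m, rfl⟩ := Nat.exists_eq_add_of_le' hm
  have : 2 * k * (m + 1) = 2 * k * m + 2 * k := by ring
  rw [numDays, lastTeams, Nat.card_Ico, Nat.add_sub_cancel, this]
  omega

theorem card_lastTeams (hm : 1 ≤ m) : (lastTeams k m r).card = 2 * (k + r) := by
  obtain ⟨m, rfl⟩ := Nat.exists_eq_add_of_le' hm
  have : 2 * k * (m + 1) = 2 * k * m + 2 * k := by ring
  rw [lastTeams, Nat.card_Ico, Nat.add_sub_cancel, this]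
  omega

theorem card_superTeam (k U : ℕ) : (superTeam k U).card = 2 * k := by
  rw [superTeam, Nat.card_Ico, mul_add]
  omega

theorem numDays_superTeam (k U : ℕ) : numDays (superTeam k U) = 2 * (2 * k - 1) := by
  rw [numDays, card_superTeam]

theorem numDays_lastTeams_eq_add (hk : 1 ≤ k) (hm : 1 ≤ m) :
    numDays (lastTeams k m r) = 4 * r + 2 * (2 * k - 1) := by
  rw [numDays_lastTeams hm]
  omega

theorem numDays_range_eq_add (hk : 1 ≤ k) (hm : 1 ≤ m) :
    numDays (Finset.range (2 * k * m + 2 * r)) =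
      4 * k * (m - 1) + numDays (lastTeams k m r) := by
  obtain ⟨m, rfl⟩ := Nat.exists_eq_add_of_le' hm
  have h1 : 2 * k * (m + 1) = 2 * k * m + 2 * k := by ring
  have h2 : 4 * k * m = 2 * (2 * k * m) := by ring
  rw [numDays_lastTeams hm, numDays, Finset.card_range, Nat.add_sub_cancel, h1, h2]
  omega

theorem mem_lastTeams_or (hk : 1 ≤ k) {v : ℕ} (hv : v < 2 * k * m + 2 * r) :
    v ∈ lastTeams k m r ∨ ∃ U < m - 1, v ∈ superTeam k U := by
  rcases lt_or_ge v (2 * k * (m - 1)) with h | h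
  · exact Or.inr ⟨v / (2 * k), Nat.div_lt_of_lt_mul h, mem_superTeam.2
      ⟨v % (2 * k), Nat.mod_lt _ (by omega), Nat.div_add_mod _ _⟩⟩
  · exact Or.inl (Finset.mem_Ico.2 ⟨h, hv⟩)

/-- The games of the super-teams other than the last one after the time slots. -/
def otherDays (k m r : ℕ) (B : ℕ → Schedule ℕ) : Schedule ℕ := fun d =>
  if d < 4 * r then leftoverGames k m d
  else (Finset.range (m - 1)).biUnion fun U => B U (d - 4 * r)

theorem finalDays_eq (k m r : ℕ) (A : Schedule ℕ) (B : ℕ → Schedule ℕ) :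
    finalDays k m r A B = fun d => A d ∪ otherDays k m r B d := rfl

theorem mirrorClosed_labelSchedule (hk : 3 ≤ k) (hm : 1 ≤ m) (δ : Bool)
    (hAB : IsLeftoverChoice k m r A B) :
    MirrorClosed (4 * k * (m - 1) + numDays (lastTeams k m r)) (labelSchedule k m r δ A B) := by
  refine MirrorClosed.append (s := fun d => slot k m r δ (d / (4 * k)) (d % (4 * k)))
    (MirrorClosed.blocks fun q _ => mirrorClosed_slot hk m r δ q) ?_
  rw [finalDays_eq]
  refine hAB.last.mirrorClosed.union ?_
  rw [numDays_lastTeams_eq_add (by omega) hm]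
  refine (mirrorClosed_leftoverGames k m r).append
    (t := fun d => (Finset.range (m - 1)).biUnion fun U => B U d) ?_
  refine MirrorClosed.biUnion fun U hU => ?_
  rw [← numDays_superTeam k U]
  exact (hAB.other U (Finset.mem_range.1 hU)).mirrorClosed

theorem card_labelSchedule_le (hk : 3 ≤ k) (hm : m % 2 = 0) (hm1 : 1 ≤ m) (δ : Bool)
    (hAB : IsLeftoverChoice k m r A B) {d : ℕ}
    (hd : d < 4 * k * (m - 1) + numDays (lastTeams k m r)) :
    (labelSchedule k m r δ A B d).card ≤ k * m + r := by
  rw [labelSchedule]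
  split_ifs with hlt
  · refine (card_slot_le hk m r δ _ _).trans (le_of_eq ?_)
    obtain ⟨c, rfl⟩ : ∃ c, m = 2 * c := ⟨m / 2, by omega⟩
    rw [Nat.mul_div_cancel_left _ (by norm_num)]
    ring
  · obtain ⟨e, rfl⟩ := Nat.exists_eq_add_of_le (not_lt.1 hlt)
    rw [Nat.add_sub_cancel_left]
    have he : e < numDays (lastTeams k m r) := by omega
    have hA := hAB.last.doubleRoundRobin.two_mul_card_le he
    rw [card_lastTeams hm1] at hA
    -- Together with the at most k + r games of `A` this makes km + r, half the number of teams, as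
    -- the criterion requires.
    have hO : (otherDays k m r B e).card ≤ (m - 1) * k := by
      rw [otherDays]
      split_ifs with her
      · exact card_leftoverGames_le k m e
      · refine Finset.card_biUnion_le.trans ((Finset.sum_le_card_nsmul _ _ k ?_).trans ?_)
        · intro U hU
          rw [numDays_lastTeams_eq_add (by omega) hm1] at he
          have := (hAB.other U (Finset.mem_range.1 hU)).doubleRoundRobin.two_mul_card_le
            (d := e - 4 * r) (by rw [numDays_superTeam]; omega)
          rw [card_superTeam] at this
          omega
        · rw [Finset.card_range, smul_eq_mul]
    calc (A e ∪ otherDays k m r B e).card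
        ≤ (A e).card + (otherDays k m r B e).card := Finset.card_union_le _ _
      _ ≤ (k + r) + (m - 1) * k := by omega
      _ = k * m + r := by
        obtain ⟨m, rfl⟩ := Nat.exists_eq_add_of_le' hm1
        rw [Nat.add_sub_cancel]
        ring

theorem exists_noRun_finalDays (hk : 3 ≤ k) (hm : 1 ≤ m) (hAB : IsLeftoverChoice k m r A B)
    {v : ℕ} (hv : v < 2 * k * m + 2 * r) : ∃ w : ℕ → Bool,
      (∀ d < numDays (lastTeams k m r), Plays (finalDays k m r A B d) v (w d)) ∧
      NoRun 3 (numDays (lastTeams k m r)) w ∧ ∃ i ≤ 2, w i ≠ w 0 := by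
  rcases mem_lastTeams_or (by omega) hv with hv | ⟨U, hU, hv⟩
  · obtain ⟨w, hw, hrun⟩ := hAB.last.exists_plays hv
    refine ⟨w, fun d hd => (hw d hd).mono Finset.subset_union_left, hrun.mono (by norm_num),
      hrun.exists_ne_zero ?_⟩
    rw [numDays_lastTeams hm]
    omega
  · obtain ⟨w, hw, hrun⟩ := (hAB.other U hU).exists_plays hv
    obtain ⟨j, hj, rfl⟩ := mem_superTeam.1 hv
    rw [numDays_superTeam] at hw hrun
    have h := noRun_leftover_append (r := r) (decide (j < k)) (by omega) hrun
    rw [numDays_lastTeams_eq_add (by omega) hm]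
    refine ⟨_, fun d hd => Plays.mono Finset.subset_union_right ?_, h⟩
    split_ifs with hdr
    · exact plays_leftoverGames hU hj d
    · exact (hw (d - 4 * r) (by omega)).mono
        (Finset.subset_biUnion_of_mem (fun U => B U (d - 4 * r)) (Finset.mem_range.2 hU))

theorem exists_noRun_labelSchedule (hk : 3 ≤ k) (hm : m % 2 = 0) (hm4 : 4 ≤ m) (hr : r < m / 2)
    (δ : Bool) (hAB : IsLeftoverChoice k m r A B) {v : ℕ} (hv : v < 2 * k * m + 2 * r) :
    ∃ w : ℕ → Bool,
      (∀ d < 4 * k * (m - 1) + numDays (lastTeams k m r),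
        Plays (labelSchedule k m r δ A B d) v (w d)) ∧
      NoRun k (4 * k * (m - 1) + numDays (lastTeams k m r)) w := by
  obtain ⟨σ, b, hσ, hplays⟩ := exists_isSlotVenue hk hm hm4 hr δ hv
  obtain ⟨w, hw, hrun, hinit⟩ := exists_noRun_finalDays hk (by omega) hAB hv
  have hD : 2 ≤ 4 * k * (m - 1) := by
    have := Nat.mul_le_mul (show 3 ≤ 4 * k by omega) (show 1 ≤ m - 1 by omega)
    omega
  refine ⟨_, fun d hd => ?_,
    (hσ.noRun hk).append hk hD (hσ.last_ne hk (by omega)) hrun hinit⟩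
  rw [labelSchedule]
  split_ifs with hlt
  · exact hplays _ (Nat.div_lt_of_lt_mul hlt) _ (Nat.mod_lt _ (by omega))
  · exact hw _ (by omega)

theorem meets_labelSchedule_of_slot (δ : Bool) {q x y : ℕ} (hq : q < m - 1)
    (h : Meets (4 * k) (slot k m r δ q) x y) :
    Meets (4 * k * (m - 1) + numDays (lastTeams k m r)) (labelSchedule k m r δ A B) x y :=
  (Meets.blocks hq h).append_left

theorem meets_labelSchedule_of_finalDays (δ : Bool) {x y : ℕ}
    (h : Meets (numDays (lastTeams k m r)) (finalDays k m r A B) x y) :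
    Meets (4 * k * (m - 1) + numDays (lastTeams k m r)) (labelSchedule k m r δ A B) x y :=
  h.append_right (s := fun d => slot k m r δ (d / (4 * k)) (d % (4 * k)))

theorem lt_of_mem_superTeam {U v : ℕ} (hU : U < m) (h : v ∈ superTeam k U) : v < 2 * k * m :=
  (Finset.mem_Ico.1 h).2.trans_le (Nat.mul_le_mul_left _ hU)

/-- The games between two super-teams other than the last one are played in a slot or are among the
leftover games. -/
theorem meets_labelSchedule_of_upper_lower (hk : 3 ≤ k) (hm : m % 2 = 0) (δ : Bool)
    {q c x y : ℕ} (hq : q < m - 1) (hc : 0 < c) (hcm : c < m / 2) (hU : upper m q c < m - 1)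
    (hx : x ∈ superTeam k (upper m q c)) (hy : y ∈ superTeam k (lower m q c)) :
    Meets (4 * k * (m - 1) + numDays (lastTeams k m r)) (labelSchedule k m r δ A B) x y := by
  by_cases hxy : ColumnMeets k m r q c x y
  · exact meets_labelSchedule_of_slot δ hq (meets_slot hk δ hcm
      (superTeam_subset_upperTeams _ _ _ _ _ hx) (superTeam_subset_lowerTeams _ _ _ _ _ hy) hxy)
  · have hxm := lt_of_mem_superTeam (show upper m q c < m by omega) hx
    rw [ColumnMeets, Classical.not_imp] at hxy
    obtain ⟨hr, hxy⟩ := hxy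
    -- `x` is in a super-team, so the game within the team-pair is not the missing one; what is left
    -- is an index sum 2k - 1, that is, a leftover game.
    have hsum : x + y = 2 * k * upper m q c + 2 * k * lower m q c + (2 * k - 1) := by
      by_contra hne
      refine hxy ⟨fun h => ?_, fun _ _ => hne⟩
      have := h.1
      unfold pairTeam at this
      omega
    obtain ⟨j, hj, rfl⟩ := mem_superTeam.1 hx
    have hmeets := meets_leftoverGames (k := k) (r := r) (i := m / 2 - 1 - c) (by omega) hU hj
    rw [← lower_eq_upper_add hm hq hc hcm,
      show 2 * k * lower m q c + (2 * k - 1 - j) = y by omega] at hmeets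
    refine meets_labelSchedule_of_finalDays δ (Meets.congr (s := otherDays k m r B) ?_
      fun d _ => Finset.subset_union_right)
    rw [numDays_lastTeams_eq_add (by omega) (by omega)]
    exact hmeets.append_left (t := fun d => (Finset.range (m - 1)).biUnion fun U => B U d)

/-- A team of `lastTeams` keeps its column and its side, while every rotating super-team passes the
position opposite to it in some slot. Neither exclusion of a right game applies: the opponent is not
in a pair, and a pair team is in no super-team. -/
theorem meets_labelSchedule_of_mem_lastTeams (hk : 3 ≤ k) (hm : m % 2 = 0) (hm4 : 4 ≤ m)
    (hr : r < m / 2) (δ : Bool) {U x y : ℕ} (hU : U < m - 1) (hx : x ∈ superTeam k U)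
    (hy : y ∈ lastTeams k m r) :
    Meets (4 * k * (m - 1) + numDays (lastTeams k m r)) (labelSchedule k m r δ A B) x y := by
  rw [lastTeams, Finset.mem_Ico] at hy
  have hxm := lt_of_mem_superTeam (show U < m by omega) hx
  rcases lt_or_ge y (2 * k * m) with hym | hym
  · have hy' : y ∈ superTeam k (m - 1) := by
      rw [superTeam, Finset.mem_Ico, Nat.sub_add_cancel (by omega)]
      exact ⟨hy.1, hym⟩
    obtain ⟨q, hq, hqU⟩ := exists_atPosition_eq (p := m - 2 - 0) (by omega) hU
    refine meets_labelSchedule_of_slot δ hq (Meets.symm ?_)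
    exact meets_slot hk δ (c := 0) (by omega)
      (superTeam_subset_upperTeams _ _ _ _ _ (by rwa [upper, if_pos rfl]))
      (superTeam_subset_lowerTeams _ _ _ _ _ (by rwa [lower, hqU])) (fun h => by omega)
  · obtain ⟨i, hi, hyi⟩ : ∃ i < r, y = 2 * k * m + 2 * i ∨ y = 2 * k * m + 2 * i + 1 :=
      ⟨(y - 2 * k * m) / 2, by omega, by omega⟩
    obtain ⟨c, hc⟩ : ∃ c, m / 2 - 1 - i = c := ⟨_, rfl⟩
    have hcr : m / 2 ≤ c + r := by omega
    have hpair : pairTeam k m c = 2 * k * m + 2 * i := by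
      unfold pairTeam
      omega
    have hnot : ∀ W < m, y ∉ superTeam k W := by
      intro W hW h
      have := lt_of_mem_superTeam hW h
      omega
    have hpos : ∀ q p, atPosition m q p < m := fun q p =>
      (Nat.mod_lt _ (by omega)).trans (by omega)
    rcases hyi with rfl | rfl
    · obtain ⟨q, hq, hqU⟩ := exists_atPosition_eq (p := m - 2 - c) (by omega) hU
      refine meets_labelSchedule_of_slot δ hq (Meets.symm ?_)
      refine meets_slot hk δ (c := c) (by omega) ?_
        (superTeam_subset_lowerTeams _ _ _ _ _ (by rwa [lower, hqU])) fun _ => ⟨?_, ?_⟩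
      · rw [upperTeams, if_pos hcr, hpair]
        exact Finset.mem_insert_self _ _
      · omega
      · rw [upper_of_pos (by omega)]
        exact fun h => absurd h (hnot _ (hpos _ _))
    · obtain ⟨q, hq, hqU⟩ := exists_atPosition_eq (p := c - 1) (by omega) hU
      refine meets_labelSchedule_of_slot δ hq ?_
      refine meets_slot hk δ (c := c) (by omega) (superTeam_subset_upperTeams _ _ _ _ _
        (by rwa [upper_of_pos (by omega), hqU])) ?_ fun _ => ⟨?_, ?_⟩
      · rw [lowerTeams, if_pos hcr, hpair]
        exact Finset.mem_insert_self _ _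
      · omega
      · exact fun _ h => absurd h (hnot _ (hpos _ _))

theorem meets_labelSchedule (hk : 3 ≤ k) (hm : m % 2 = 0) (hm4 : 4 ≤ m) (hr : r < m / 2)
    (δ : Bool) (hAB : IsLeftoverChoice k m r A B) {x y : ℕ} (hx : x < 2 * k * m + 2 * r)
    (hy : y < 2 * k * m + 2 * r) (hxy : x ≠ y) :
    Meets (4 * k * (m - 1) + numDays (lastTeams k m r)) (labelSchedule k m r δ A B) x y := by
  rcases mem_lastTeams_or (by omega) hx with hx | ⟨U, hU, hx⟩ <;>
    rcases mem_lastTeams_or (by omega) hy with hy | ⟨W, hW, hy⟩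
  · exact meets_labelSchedule_of_finalDays δ ((hAB.last.doubleRoundRobin.meets hx hy hxy).congr
      fun d _ => Finset.subset_union_left)
  · exact (meets_labelSchedule_of_mem_lastTeams hk hm hm4 hr δ hW hy hx).symm
  · exact meets_labelSchedule_of_mem_lastTeams hk hm hm4 hr δ hU hx hy
  by_cases hUW : U = W
  · subst hUW
    refine meets_labelSchedule_of_finalDays δ (Meets.congr (s := otherDays k m r B) ?_
      fun d _ => Finset.subset_union_right)
    have h := (hAB.other U hU).doubleRoundRobin.meets hx hy hxy
    rw [numDays_superTeam] at h
    rw [numDays_lastTeams_eq_add (by omega) (by omega)]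
    exact (h.congr (t := fun d => (Finset.range (m - 1)).biUnion fun U => B U d)
      fun d _ => Finset.subset_biUnion_of_mem (fun U => B U d) (Finset.mem_range.2 hU)).append_right
  · obtain ⟨q, hq, c, hc, hcm, ⟨rfl, rfl⟩ | ⟨rfl, rfl⟩⟩ := exists_upper_lower hm hU hW hUW
    · exact meets_labelSchedule_of_upper_lower hk hm δ hq hc hcm hU hx hy
    · exact (meets_labelSchedule_of_upper_lower hk hm δ hq hc hcm hW hy hx).symm

theorem isFeasible_labelSchedule (hk : 3 ≤ k) (hm : m % 2 = 0) (hm4 : 4 ≤ m) (hr : r < m / 2)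
    (δ : Bool) (hAB : IsLeftoverChoice k m r A B) :
    IsFeasible k (Finset.range (2 * k * m + 2 * r)) (labelSchedule k m r δ A B) := by
  have hdays := numDays_range_eq_add (k := k) (m := m) (r := r) (by omega) (by omega)
  refine isFeasible_of_plays (h := k * m + r) (by rw [Finset.card_range]; ring) ?_ ?_ ?_ ?_
  · rw [hdays]
    exact fun d hd => card_labelSchedule_le hk hm (by omega) δ hAB hd
  · rw [hdays]
    exact mirrorClosed_labelSchedule hk (by omega) δ hAB
  · rw [hdays]
    exact fun x hx y hy hxy => meets_labelSchedule hk hm hm4 hr δ hAB (Finset.mem_range.1 hx)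
      (Finset.mem_range.1 hy) hxy
  · rw [hdays]
    exact fun v hv => exists_noRun_labelSchedule hk hm hm4 hr δ hAB (Finset.mem_range.1 hv)

theorem isFeasible_packingSchedule {V : Type*} [Fintype V] {n : ℕ} (hk : 3 ≤ k)
    (hn : 2 * k * numSuper k n + 2 * numPairs k n = n) (hm4 : 4 ≤ numSuper k n)
    (hr : numPairs k n < numSuper k n / 2) (t : Fin n ≃ V) (δ : Bool)
    (hAB : IsLeftoverChoice k (numSuper k n) (numPairs k n) A B) :
    IsFeasible k Finset.univ (packingSchedule k t δ A B) := by
  have h := isFeasible_labelSchedule hk (by rw [numSuper, Nat.mul_mod_right]) hm4 hr δ hAB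
  rw [hn] at h
  refine h.of_bijOn (fun v => (t.symm v : ℕ)) ⟨?_, ?_, ?_⟩ ?_
  · intro v _
    simp
  · intro v _ w _ hvw
    exact t.symm.injective (Fin.ext hvw)
  · intro x hx
    simp only [Finset.coe_range, Set.mem_Iio] at hx
    exact ⟨t ⟨x, hx⟩, by simp, by simp⟩
  · intro d _ a b
    simp [packingSchedule]

end Assembly

/-! ### Arithmetic of m and r, and the theorem -/

theorem two_mul_numSuper_add_numPairs {k n : ℕ} (hn : Even n) :
    2 * k * numSuper k n + 2 * numPairs k n = n := by
  have h1 := Nat.mul_div_le n (4 * k)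
  have h2 : 2 * k * numSuper k n = 4 * k * (n / (4 * k)) := by
    unfold numSuper
    ring
  have h3 : 2 * numSuper k n * k = 2 * (2 * (k * (n / (4 * k)))) := by
    unfold numSuper
    ring
  have h4 : 4 * k * (n / (4 * k)) = 2 * (2 * (k * (n / (4 * k)))) := by ring
  have h5 := Nat.even_iff.1 hn
  rw [numPairs, h2, h3]
  omega

/-- 2r is the remainder of n modulo 4k up to parity rounding, and n ≥ 8k² makes the quotient at
least 2k. So there are more columns than team-pairs, and column 0 is never a right one. -/
theorem numPairs_lt {k n : ℕ} (hk : 3 ≤ k) (hnk : 8 * k ^ 2 ≤ n) :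
    numPairs k n < 2 * k ∧ 2 * k ≤ numSuper k n / 2 := by
  have h1 := Nat.div_add_mod n (4 * k)
  have h2 := Nat.mod_lt n (show 0 < 4 * k by omega)
  have h3 : 2 * numSuper k n * k = 4 * k * (n / (4 * k)) := by
    unfold numSuper
    ring
  constructor
  · rw [numPairs, h3]
    omega
  · rw [numSuper, Nat.mul_div_cancel_left _ (by norm_num), Nat.le_div_iff_mul_le (by omega)]
    calc 2 * k * (4 * k) = 8 * k ^ 2 := by ring
      _ ≤ n := hnk

end TTP

theorem mainTheorem6 {V : Type*} [Fintype V] (k n : ℕ) (hk : 3 ≤ k)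
    (hV : Fintype.card V = n) (hn : Even n) (hnk : 8 * k ^ 2 ≤ n)
    (S : Finset V) (hS : S.card = 2 * TTP.numSuper k n * k)
    (P : SimpleGraph S) (hP : TTP.IsCyclePacking k P) :
    (∃ t : Fin n ≃ V, TTP.IsLabelling k (TTP.numSuper k n) S P t) ∧
    (∃ A B, TTP.IsLeftoverChoice k (TTP.numSuper k n) (TTP.numPairs k n) A B) ∧
    ∀ (t : Fin n ≃ V), TTP.IsLabelling k (TTP.numSuper k n) S P t →
      ∀ (δ : Bool) (A : TTP.Schedule ℕ) (B : ℕ → TTP.Schedule ℕ),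
        TTP.IsLeftoverChoice k (TTP.numSuper k n) (TTP.numPairs k n) A B →
          TTP.IsFeasible k Finset.univ (TTP.packingSchedule k t δ A B) := by
  obtain ⟨hr, hm⟩ := TTP.numPairs_lt hk hnk
  exact ⟨TTP.exists_isLabelling hk hV hS hP,
    TTP.exists_isLeftoverChoice hk (by omega) _,
    fun t _ δ A B hAB => TTP.isFeasible_packingSchedule hk (TTP.two_mul_numSuper_add_numPairs hn)
      (by omega) (by omega) t δ hAB⟩
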